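/- Let $S=\Omega/\Gamma$ be a closed oriented surface with a strictly convex real projective structure: $\Omega\subset\mathbb{RP}^2$ is a strictly convex, properly convex open domain and $\Gamma\subset SL(3,\mathbb R)$, the image of the holonomy of $\pi_1(S)$, preserves (the cone over) $\Omega$ and acts on $\Omega$ freely, properly discontinuously and cocompactly. (Then $S$ has genus at least $2$.) Let $\gamma$ be a simple closed geodesic on $S$. After conjugation, $\rho(\gamma)=\mathrm{diag}(e^{t_1},e^{t_2},e^{t_3})\in\Gamma$ with $t_1>t_2>t_3$, its attracting, neutral and repelling fixed points $\gamma_+,\gamma_0,\gamma_-$ are the coordinate points, and the lift $\tilde\gamma=\{[x:0:z]: x,z>0\}$ of $\gamma$ lies in $\Omega$; the translates of $\tilde\gamma$ by $\Gamma$ (the lifts of $\gamma$) are pairwise equal or disjoint. The right side of $\tilde\gamma$ is the side on which the second coordinate is positive (the first and third being positive on $\tilde\gamma$), and $K^L$, $K^R$ are the components of $\Omega\setminus\{\text{lifts of }\gamma\}$ adjacent to $\tilde\gamma$ on its left and on its right. For $s\in\mathbb R$ let $O_s=\mathrm{diag}(e^{-s/3},e^{2s/3},e^{-s/3})$, and let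 $\Gamma_1,\Gamma_2\subset\Gamma$ be the stabilisers of $K^L$ and $K^R$. The bulging deformation along $\gamma$ has the holonomy group $\Gamma_s=\langle \Gamma_1,\,O_s\Gamma_2O_s^{-1}\rangle$ if $\gamma$ separates $S$, and $\Gamma_s=\langle\Gamma_1,\,O_s\gamma_2\rangle$ if it does not, where $\gamma_2\in\Gamma$ is any element with $\gamma_2K^L=K^R$. The bulged domain is $$\Omega_s=\bigcup_{g\in\Gamma_s} g\bigl(\overline{K^L}\cup O_s\overline{K^R}\bigr)$$ (closures taken in $\Omega$), and the bulged surface is $S_s=\Omega_s/\Gamma_s$. All lengths and distances on $S_s$ are those of the Hilbert metric $d_{\Omega_s}(x,y)=\frac12\log\frac{|p-y||q-x|}{|p-x||q-y|}$, where $p,q$ are the points of $\partial\Omega_s$ on the line $xy$, in the order $p,x,y,q$. A subset of $K^L$ is regarded as a subset of $\Omega_s$ unchanged, and a subset of $K^R$ through $O_s$. Then, as $s\to\infty$, the length of the cylinder around $\gamma$ between the left and the right side of $S\setminus\gamma$ grows in the order of $s$. Precisely, let $A\subset K^L$ and $B\subset K^R$ be nonempty and compact. (If the complement in $S$ of the images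 of $A$ and $B$ is an open annulus around $\gamma$, the quantities below are the length of this cylinder in $S_s$.) There are constants $c,c'>0$ and $s_0$, depending on $\Omega,\Gamma,A,B$ but not on $s$, such that for all $s\ge s_0$: 1. if $\gamma$ separates $S$, the distance in $S_s$ between the image of $A$ in the left component and the image of $O_sB$ in the right component satisfies $$c\,s\;\le\;\inf_{a\in A,\;b\in B,\;g\in\Gamma_s} d_{\Omega_s}(a,\,gO_sb)\;\le\;c'\,s;$$ 2. if $\gamma$ does not separate $S$, the infimum of the lengths of the arcs in $S_s$ from the image of $A$ to the image of $O_sB$ that cannot be deformed, with fixed endpoints, into the complement of $\gamma$ satisfies $$c\,s\;\le\;\inf\{\,d_{\Omega_s}(a,\,gO_sb)\;:\;a\in A,\ b\in B,\ g\in\Gamma_s,\ gO_sb\notin K^L\,\}\;\le\;c'\,s.$$ -/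

import Mathlib

namespace Bulging

/-- The vector space `ℝ³`, whose rays are the points of the (double cover of the) projective plane. -/
abbrev V : Type := Fin 3 → ℝ

/-- The group `SL(3, ℝ)`. -/
abbrev SL3 : Type := Matrix.SpecialLinearGroup (Fin 3) ℝ

/-- The linear action of `SL(3, ℝ)` on `ℝ³`. -/
def act (g : SL3) (x : V) : V := Matrix.mulVec (g : Matrix (Fin 3) (Fin 3) ℝ) x

/-- The translate `g X` of a subset of `ℝ³`. -/
def translate (g : SL3) (X : Set V) : Set V := act g '' X

/-- A strictly convex real projective structure on a closed oriented surface, presented as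
`S = Ω / Γ`.  The domain `Ω` of the projective plane is given by the open cone `C` in `ℝ³` over it,
so a point of `Ω` is an open ray of `C`; the group `Γ` is the image of the holonomy representation
in `SL(3, ℝ)`.  Elements of `Γ` map `C` to `C` (and not to `-C`), that is, they preserve the
orientation of `Ω`.  A closed surface with strictly convex `Ω` has genus at least `2`. -/
structure IsStrictlyConvexSurface (C : Set V) (Γ : Subgroup SL3) : Prop where
  isOpen : IsOpen C
  nonempty : C.Nonempty
  cone : ∀ x ∈ C, ∀ r : ℝ, 0 < r → r • x ∈ C
  convex : Convex ℝ C
  /-- The closure of `Ω` lies in an affine chart. -/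
  proper : ∀ x ∈ closure C, -x ∈ closure C → x = 0
  /-- The boundary of `Ω` contains no segment. -/
  strict : ∀ x ∈ frontier C, ∀ y ∈ frontier C, ¬ SameRay ℝ x y → x + y ∈ C
  invariant : ∀ g ∈ Γ, translate g C = C
  /-- The action of `Γ` on `Ω` is free. -/
  free : ∀ g ∈ Γ, ∀ x ∈ C, ∀ r : ℝ, 0 < r → act g x = r • x → g = 1
  /-- The action of `Γ` on `Ω` is properly discontinuous. -/
  properlyDiscontinuous : ∀ K : Set V, K ⊆ C → IsCompact K →
    {g : SL3 | g ∈ Γ ∧ ∃ x ∈ K, ∃ r : ℝ, 0 < r ∧ r • act g x ∈ K}.Finite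
  /-- The quotient `Ω / Γ` is compact. -/
  cocompact : ∃ K : Set V, K ⊆ C ∧ IsCompact K ∧
    ∀ x ∈ C, ∃ g ∈ Γ, ∃ r : ℝ, 0 < r ∧ r • act g x ∈ K

/-- The Hilbert distance between the points of `Ω` given by `x` and `y`.  After rescaling the
representatives, the line through them meets the boundary in `p` and `q`, with `p, x, y, q` in this
order, and the distance is half the logarithm of the cross ratio of the four points.  (The four
points are collinear, so the norm does not matter; for a properly convex domain the cross ratio does
not depend on the representatives.  If `x` and `y` are the same point of `Ω`, the set below is
empty and the value is `0`.) -/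
noncomputable def hilbertDist (C : Set V) (x y : V) : ℝ :=
  sInf {d : ℝ | ∃ a b : ℝ, 0 < a ∧ 0 < b ∧ ∃ p ∈ frontier C, ∃ q ∈ frontier C,
    Sbtw ℝ p (a • x) (b • y) ∧ Sbtw ℝ (a • x) (b • y) q ∧
    d = 1 / 2 * Real.log
      ((dist p (b • y) * dist q (a • x)) / (dist p (a • x) * dist q (b • y)))}

/-- The distance in the surface `Ω / Γ` between the images of the subsets `A`, `B` of `Ω`. -/
noncomputable def surfaceDist (C : Set V) (Γ : Subgroup SL3) (A B : Set V) : ℝ :=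
  sInf {d : ℝ | ∃ a ∈ A, ∃ b ∈ B, ∃ g ∈ Γ, d = hilbertDist C a (act g b)}

/-- For `A` inside `K`: the length of a shortest arc in the surface `Ω / Γ` from the image of `A` to
the image of `B` whose lift starting in `A` ends outside `K`. -/
noncomputable def crossingDist (C : Set V) (Γ : Subgroup SL3) (K A B : Set V) : ℝ :=
  sInf {d : ℝ | ∃ a ∈ A, ∃ b ∈ B, ∃ g ∈ Γ, act g b ∉ K ∧ d = hilbertDist C a (act g b)}

/-- The open segment `γ₋γ₊`, where `γ₊`, `γ₀`, `γ₋` are the three coordinate points. -/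
def axis : Set V := {x | 0 < x 0 ∧ x 1 = 0 ∧ 0 < x 2}

/-- `γ` is (the holonomy of) a closed loop that is freely homotopic to a multiple of a simple closed
geodesic, normalised by conjugation: `γ` is diagonal with decreasing positive eigenvalues, so that
its attracting, neutral and repelling fixed points are the coordinate points, and its axis is
`axis`.  Simplicity means that distinct lifts of the geodesic are disjoint. -/
structure IsSimpleClosedGeodesic (C : Set V) (Γ : Subgroup SL3) (γ : SL3) : Prop where
  mem : γ ∈ Γ
  diagonal : ∃ t : Fin 3 → ℝ, t 1 < t 0 ∧ t 2 < t 1 ∧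
    (γ : Matrix (Fin 3) (Fin 3) ℝ) = Matrix.diagonal fun i => Real.exp (t i)
  axis_subset : axis ⊆ C
  simple : ∀ g ∈ Γ, translate g axis = axis ∨ Disjoint (translate g axis) axis

/-- The union of all lifts of the geodesic to `Ω`. -/
def lifts (Γ : Subgroup SL3) : Set V := ⋃ g ∈ Γ, translate g axis

/-- The component `K^R` of `Ω` minus the lifts that is adjacent to `axis` on its right side, the
side on which the second coordinate is positive. -/
def regionRight (C : Set V) (Γ : Subgroup SL3) : Set V :=
  {x | x ∈ C \ lifts Γ ∧ 0 < x 1 ∧ axis ⊆ closure (connectedComponentIn (C \ lifts Γ) x)}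

/-- The component `K^L` of `Ω` minus the lifts that is adjacent to `axis` on its left side. -/
def regionLeft (C : Set V) (Γ : Subgroup SL3) : Set V :=
  {x | x ∈ C \ lifts Γ ∧ x 1 < 0 ∧ axis ⊆ closure (connectedComponentIn (C \ lifts Γ) x)}

/-- The geodesic separates the surface: its left and right sides lie in different components of the
complement of the geodesic. -/
def IsSeparating (C : Set V) (Γ : Subgroup SL3) : Prop :=
  ∀ g ∈ Γ, translate g (regionLeft C Γ) ≠ regionRight C Γ

/-- The bulging matrix `O_s`. -/
noncomputable def bulge (s : ℝ) : SL3 :=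
  ⟨Matrix.diagonal ![Real.exp (-(1 / 3) * s), Real.exp (2 / 3 * s), Real.exp (-(1 / 3) * s)], by
    rw [Matrix.det_diagonal, Fin.prod_univ_three]
    simp only [Matrix.cons_val]
    rw [← Real.exp_add, ← Real.exp_add, Real.exp_eq_one_iff]
    ring⟩

/-- The holonomy group `ρ_s(π₁ S)` of the bulged structure.  With `Γ₁`, `Γ₂` the stabilisers of
`K^L`, `K^R`, it is generated by `Γ₁` and `O_s Γ₂ O_s⁻¹` if the geodesic separates.  If it does not
separate, the third set is nonempty and the group is generated by `Γ₁` and `O_s γ₂`, where `γ₂`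
in `Γ` is any element that maps `K^L` to `K^R` (the second set is then redundant). -/
noncomputable def bulgedGroup (C : Set V) (Γ : Subgroup SL3) (s : ℝ) : Subgroup SL3 :=
  Subgroup.closure
    ({g | g ∈ Γ ∧ translate g (regionLeft C Γ) = regionLeft C Γ} ∪
      {h | ∃ g ∈ Γ, translate g (regionRight C Γ) = regionRight C Γ ∧
        h = bulge s * g * (bulge s)⁻¹} ∪
      {h | ∃ g ∈ Γ, translate g (regionLeft C Γ) = regionRight C Γ ∧ h = bulge s * g})

/-- The bulged domain `Ω_s`, containing `K^L`: the union of the translates, by the bulged holonomy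
group, of `K^L` and `O_s K^R`, both taken with their bounding lifts. -/
noncomputable def bulgedDomain (C : Set V) (Γ : Subgroup SL3) (s : ℝ) : Set V :=
  ⋃ g ∈ bulgedGroup C Γ s, translate g
    ((closure (regionLeft C Γ) ∩ C) ∪ translate (bulge s) (closure (regionRight C Γ) ∩ C))

end Bulging

namespace Bulging

open Filter Topology

/-! If the line through `x` and `y` meets the boundary in the rays of `x - τ y` and `y - σ x`, the
Hilbert distance is `-½ log (τσ)` (`hilbertDist_eq_sInf_of_isCone`). So it suffices that `τσ` is
comparable to `exp (-s)`; the distance is in fact `s/2 + O(1)`. Convexity of `Ω_s` never enters.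

Upper bound (`exists_hilbertDist_le`): `Ω_s` contains a fixed ball around `a` and the `O_s`-image of
a fixed ball around `b`. As `O_s` and its inverse have norm at most `exp (2s/3)` and `exp (s/3)`,
`τσ` is at least a constant times `exp (-s)`.

Lower bound: the lines `x₀ = 0` and `x₂ = 0` touch `Ω` at the endpoints of the axis and bound, with
the axis, a triangle on each side. For any other lift bounding an adjacent piece, the triangle on
its far side lies inside a triangle of the axis (`middle_column`, `act_mem_openTriangle`). Bulging
preserves the triangles of the axis, so a ping-pong argument along normal words (`IsNormalWord`)
keeps all of `Ω_s` between the two lines, for every `s`. One more linear functional, positive at the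
neutral fixed point and independent of `s`, is nonnegative on every `Ω_s`
(`exists_functional_bulgedDomain`).

On the other hand the pieces beyond the axis keep a definite depth `x₁ / min (x₀, x₂)`, uniformly in
`s` and in the word (`exists_isDeep`), and `O_s` multiplies depth by `exp s`. Some element of `Γ_s`
moves the two points to opposite sides of the axis, one of them at depth at least `ε exp s`
(`exists_separating_translate`). Since the functional limits how far `Ω_s` extends towards the
negative of the neutral point, this forces `τσ ≤ K exp (-s)` (`mul_le_of_isDeep`). -/

/-! ### The linear action and the bulging matrices. -/

theorem act_apply (g : SL3) (x : V) (i : Fin 3) :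
    act g x i = g.1 i 0 * x 0 + g.1 i 1 * x 1 + g.1 i 2 * x 2 := by
  simp [act, Matrix.mulVec, dotProduct, Fin.sum_univ_three]

theorem act_mul (g h : SL3) (x : V) : act (g * h) x = act g (act h x) := by
  simp [act, Matrix.mulVec_mulVec]

@[simp] theorem act_one (x : V) : act 1 x = x := by simp [act]

@[simp] theorem act_inv_act (g : SL3) (x : V) : act g⁻¹ (act g x) = x := by
  rw [← act_mul]; simp

@[simp] theorem act_act_inv (g : SL3) (x : V) : act g (act g⁻¹ x) = x := by
  rw [← act_mul]; simp

theorem act_add (g : SL3) (x y : V) : act g (x + y) = act g x + act g y := Matrix.mulVec_add _ _ _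

theorem act_sub (g : SL3) (x y : V) : act g (x - y) = act g x - act g y := Matrix.mulVec_sub _ _ _

theorem act_smul (g : SL3) (r : ℝ) (x : V) : act g (r • x) = r • act g x :=
  Matrix.mulVec_smul _ _ _

theorem continuous_act (g : SL3) : Continuous (act g) := by
  unfold act; fun_prop

/-- The linear action of an element of `SL(3, ℝ)` as a homeomorphism. -/
def actHomeomorph (g : SL3) : V ≃ₜ V where
  toFun := act g
  invFun := act g⁻¹
  left_inv := act_inv_act g
  right_inv := act_act_inv g
  continuous_toFun := continuous_act g
  continuous_invFun := continuous_act g⁻¹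

theorem coe_actHomeomorph (g : SL3) : ⇑(actHomeomorph g) = act g := rfl

theorem mem_translate {g : SL3} {X : Set V} {x : V} : x ∈ translate g X ↔ act g⁻¹ x ∈ X := by
  constructor
  · rintro ⟨y, hy, rfl⟩; simpa using hy
  · intro h; exact ⟨_, h, by simp⟩

theorem translate_mul (g h : SL3) (X : Set V) :
    translate (g * h) X = translate g (translate h X) := by
  ext x; simp only [mem_translate, mul_inv_rev, act_mul]

@[simp] theorem translate_one (X : Set V) : translate 1 X = X := by
  ext x; simp [mem_translate]

theorem translate_inv_eq {g : SL3} {X Y : Set V} (h : translate g X = Y) :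
    translate g⁻¹ Y = X := by
  rw [← h, ← translate_mul]; simp

theorem act_mem_translate (g : SL3) {X : Set V} {x : V} (h : x ∈ X) : act g x ∈ translate g X :=
  ⟨x, h, rfl⟩

theorem closure_translate (g : SL3) (X : Set V) :
    closure (translate g X) = translate g (closure X) :=
  ((actHomeomorph g).image_closure X).symm

theorem frontier_translate (g : SL3) (X : Set V) :
    frontier (translate g X) = translate g (frontier X) :=
  ((actHomeomorph g).image_frontier X).symm

theorem isOpen_translate (g : SL3) {X : Set V} (h : IsOpen X) : IsOpen (translate g X) :=
  (actHomeomorph g).isOpenMap X h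

theorem act_bulge_zero (s : ℝ) (x : V) : act (bulge s) x 0 = Real.exp (-(1 / 3) * s) * x 0 := by
  simp [act, bulge, Matrix.mulVec_diagonal]

theorem act_bulge_one (s : ℝ) (x : V) : act (bulge s) x 1 = Real.exp (2 / 3 * s) * x 1 := by
  simp [act, bulge, Matrix.mulVec_diagonal]

theorem act_bulge_two (s : ℝ) (x : V) : act (bulge s) x 2 = Real.exp (-(1 / 3) * s) * x 2 := by
  simp [act, bulge, Matrix.mulVec_diagonal]

theorem SL3.ext_act {g h : SL3} (H : ∀ x, act g x = act h x) : g = h := by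
  apply Subtype.ext
  exact Matrix.mulVec_injective (funext H)

theorem bulge_mul_bulge_neg (s : ℝ) : bulge s * bulge (-s) = 1 := by
  refine SL3.ext_act fun x => ?_
  rw [act_mul, act_one]
  funext i
  fin_cases i
  · simp only [Fin.zero_eta, act_bulge_zero, ← mul_assoc, ← Real.exp_add]; simp
  · simp only [Fin.mk_one, act_bulge_one, ← mul_assoc, ← Real.exp_add]; simp
  · simp only [Fin.reduceFinMk, act_bulge_two, ← mul_assoc, ← Real.exp_add]; simp

theorem bulge_neg (s : ℝ) : bulge (-s) = (bulge s)⁻¹ :=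
  eq_inv_of_mul_eq_one_right (bulge_mul_bulge_neg s)

/-! ### The Hilbert distance of a cone through the parameters `τ` and `σ`. -/

/-- A subset of `ℝ³` that is a union of open rays. -/
def IsCone (D : Set V) : Prop := ∀ x ∈ D, ∀ r : ℝ, 0 < r → r • x ∈ D

/-- Multiplication by a positive number as a homeomorphism. -/
noncomputable def scaleHomeomorph (r : ℝ) (hr : 0 < r) : V ≃ₜ V := Homeomorph.smulOfNeZero r hr.ne'

theorem coe_scaleHomeomorph (r : ℝ) (hr : 0 < r) (x : V) : scaleHomeomorph r hr x = r • x := rfl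

theorem IsCone.image_scale {D : Set V} (h : IsCone D) (r : ℝ) (hr : 0 < r) :
    scaleHomeomorph r hr '' D = D := by
  ext x
  constructor
  · rintro ⟨y, hy, rfl⟩; exact h y hy r hr
  · intro hx
    refine ⟨r⁻¹ • x, h x hx _ (inv_pos.2 hr), ?_⟩
    rw [coe_scaleHomeomorph, smul_inv_smul₀ hr.ne']

theorem IsCone.frontier {D : Set V} (h : IsCone D) : IsCone (frontier D) := by
  intro x hx r hr
  have := (scaleHomeomorph r hr).image_frontier D
  rw [h.image_scale] at this
  rw [← this]
  exact ⟨x, hx, rfl⟩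

theorem IsCone.closure {D : Set V} (h : IsCone D) : IsCone (closure D) := by
  intro x hx r hr
  have := (scaleHomeomorph r hr).image_closure D
  rw [h.image_scale] at this
  rw [← this]
  exact ⟨x, hx, rfl⟩

/-- The set of which `hilbertDist` is the infimum, in terms of the points `x - τ y` and `y - σ x`
of the boundary cone. -/
theorem hilbertDist_eq_sInf_of_isCone {D : Set V} (hD : IsCone D) {x y : V}
    (hne : ∀ ρ : ℝ, 0 < ρ → x ≠ ρ • y) :
    hilbertDist D x y = sInf {d : ℝ | ∃ τ σ : ℝ, 0 < τ ∧ 0 < σ ∧ τ * σ < 1 ∧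
      x - τ • y ∈ frontier D ∧ y - σ • x ∈ frontier D ∧ d = -(1 / 2) * Real.log (τ * σ)} := by
  unfold hilbertDist
  congr 1
  ext d
  constructor
  · rintro ⟨a, b, ha, hb, p, hp, q, hq, h1, h2, rfl⟩
    rw [sbtw_iff_mem_image_Ioo_and_ne] at h1 h2
    obtain ⟨⟨t, ⟨ht0, ht1⟩, ht⟩, hpb⟩ := h1
    obtain ⟨⟨u, ⟨hu0, hu1⟩, hu⟩, haq⟩ := h2
    -- Solving the betweenness relation for `p` shows `τ = t b / a`; likewise `σ = (1 - u) a / b`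
    -- below. The scales `a`, `b` cancel in `τσ`.
    have e1 : x - (t * b / a) • y = ((1 - t) / a) • p := by
      funext i
      have := congrFun ht i
      simp only [AffineMap.lineMap_apply_module, Pi.add_apply, Pi.smul_apply, smul_eq_mul] at this
      simp only [Pi.sub_apply, Pi.smul_apply, smul_eq_mul]
      field_simp
      linarith
    have e2 : y - ((1 - u) * a / b) • x = (u / b) • q := by
      funext i
      have := congrFun hu i
      simp only [AffineMap.lineMap_apply_module, Pi.add_apply, Pi.smul_apply, smul_eq_mul] at this
      simp only [Pi.sub_apply, Pi.smul_apply, smul_eq_mul]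
      field_simp
      linarith
    have hu1' : 0 < 1 - u := by linarith
    have ht1' : 0 < 1 - t := by linarith
    have hts : t * b / a * ((1 - u) * a / b) = t * (1 - u) := by field_simp
    refine ⟨t * b / a, (1 - u) * a / b, by positivity, by positivity, ?_, ?_, ?_, ?_⟩
    · rw [hts]; nlinarith
    · rw [e1]; exact hD.frontier p hp _ (by positivity)
    · rw [e2]; exact hD.frontier q hq _ (by positivity)
    · have d1 : dist p (a • x) = t * dist p (b • y) := by
        rw [← ht, dist_left_lineMap, Real.norm_of_nonneg ht0.le]
      have d2 : dist q (b • y) = (1 - u) * dist q (a • x) := by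
        rw [← hu, dist_right_lineMap, Real.norm_of_nonneg hu1'.le, dist_comm q, dist_comm]
      have p1 : dist p (b • y) ≠ 0 := dist_ne_zero.2 hpb
      have p2 : dist q (a • x) ≠ 0 := dist_ne_zero.2 haq.symm
      rw [d1, d2, hts]
      have : dist p (b • y) * dist q (a • x) /
          (t * dist p (b • y) * ((1 - u) * dist q (a • x))) = (t * (1 - u))⁻¹ := by
        field_simp
      rw [this, Real.log_inv]; ring
  · rintro ⟨τ, σ, hτ, hσ, h, hp, hq, rfl⟩
    -- The order `p, x, ρ y, q` holds exactly for scales `ρ` strictly between `τ` and `σ⁻¹`; the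
    -- resulting cross ratio `(τσ)⁻¹` does not depend on the choice.
    obtain ⟨ρ, h1, h2⟩ : ∃ ρ, τ < ρ ∧ ρ < σ⁻¹ := exists_between (by
      rw [lt_inv_comm₀ hτ hσ, ← one_div, lt_div_iff₀ hτ]; linarith)
    have hρ : 0 < ρ := hτ.trans h1
    have hσρ : σ * ρ < 1 := by
      have := mul_lt_mul_of_pos_left h2 hσ
      rwa [mul_inv_cancel₀ hσ.ne'] at this
    have ht0 : 0 < τ / ρ := by positivity
    have ht1 : τ / ρ < 1 := (div_lt_one hρ).2 h1
    have ht1' : 0 < 1 - τ / ρ := by linarith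
    have hu0 : 0 < σ * ρ := by positivity
    have hu1' : 0 < 1 - σ * ρ := by linarith
    have hxy := hne ρ hρ
    have hD' := hD.frontier
    set p : V := (1 - τ / ρ)⁻¹ • (x - τ • y) with hpdef
    set q : V := (ρ / (1 - σ * ρ)) • (y - σ • x) with hqdef
    have ht : AffineMap.lineMap p (ρ • y) (τ / ρ) = (1 : ℝ) • x := by
      rw [AffineMap.lineMap_apply_module, hpdef, smul_inv_smul₀ ht1'.ne', smul_smul,
        div_mul_cancel₀ _ hρ.ne', one_smul, sub_add_cancel]
    have hu : AffineMap.lineMap ((1 : ℝ) • x) q (1 - σ * ρ) = ρ • y := by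
      rw [AffineMap.lineMap_apply_module, hqdef, smul_smul _ _ (y - σ • x),
        mul_div_cancel₀ _ hu1'.ne']
      module
    have hpb : p ≠ ρ • y := by
      intro h; rw [h, AffineMap.lineMap_same_apply, one_smul] at ht; exact hxy ht.symm
    have haq : (1 : ℝ) • x ≠ q := by
      intro h; rw [← h, AffineMap.lineMap_same_apply, one_smul] at hu; exact hxy hu
    refine ⟨1, ρ, one_pos, hρ, p, hD' _ hp _ (by positivity), q, hD' _ hq _ (by positivity),
      ?_, ?_, ?_⟩
    · rw [sbtw_iff_mem_image_Ioo_and_ne]; exact ⟨⟨_, ⟨ht0, ht1⟩, ht⟩, hpb⟩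
    · rw [sbtw_iff_mem_image_Ioo_and_ne]; exact ⟨⟨_, ⟨hu1', by linarith⟩, hu⟩, haq⟩
    · have d1 : dist p ((1 : ℝ) • x) = τ / ρ * dist p (ρ • y) := by
        rw [← ht, dist_left_lineMap, Real.norm_of_nonneg ht0.le]
      have d2 : dist q (ρ • y) = σ * ρ * dist q ((1 : ℝ) • x) := by
        rw [← hu, dist_right_lineMap, Real.norm_of_nonneg (by linarith), dist_comm q, dist_comm]
        ring
      have p1 : dist p (ρ • y) ≠ 0 := dist_ne_zero.2 hpb
      have p2 : dist q ((1 : ℝ) • x) ≠ 0 := dist_ne_zero.2 haq.symm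
      rw [d1, d2]
      have : dist p (ρ • y) * dist q ((1 : ℝ) • x) /
          (τ / ρ * dist p (ρ • y) * (σ * ρ * dist q ((1 : ℝ) • x))) = (τ * σ)⁻¹ := by
        field_simp
      rw [this, Real.log_inv]; ring

/-- One boundary pair bounds the infimum from above. No pair need exist, because an empty set has
`sInf` equal to `0`, and the bound is nonnegative since `c ≤ 1`. -/
theorem hilbertDist_le_of_forall {D : Set V} (hD : IsCone D) {x y : V}
    (hne : ∀ ρ : ℝ, 0 < ρ → x ≠ ρ • y) {c : ℝ} (hc : 0 < c) (hc1 : c ≤ 1)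
    (h : ∀ τ σ : ℝ, 0 < τ → 0 < σ → x - τ • y ∈ frontier D → y - σ • x ∈ frontier D →
      c ≤ τ * σ) :
    hilbertDist D x y ≤ -(1 / 2) * Real.log c := by
  rw [hilbertDist_eq_sInf_of_isCone hD hne]
  rcases Set.eq_empty_or_nonempty {d : ℝ | ∃ τ σ : ℝ, 0 < τ ∧ 0 < σ ∧ τ * σ < 1 ∧
      x - τ • y ∈ frontier D ∧ y - σ • x ∈ frontier D ∧ d = -(1 / 2) * Real.log (τ * σ)} with h0 | h0
  · rw [h0, Real.sInf_empty]
    have := Real.log_nonpos hc.le hc1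
    linarith
  · obtain ⟨d, τ, σ, hτ, hσ, h1, hp, hq, rfl⟩ := h0
    have hmem : -(1 / 2) * Real.log (τ * σ) ∈ {d : ℝ | ∃ τ σ : ℝ, 0 < τ ∧ 0 < σ ∧ τ * σ < 1 ∧
      x - τ • y ∈ frontier D ∧ y - σ • x ∈ frontier D ∧ d = -(1 / 2) * Real.log (τ * σ)} :=
      ⟨τ, σ, hτ, hσ, h1, hp, hq, rfl⟩
    refine (csInf_le ?_ hmem).trans ?_
    · refine ⟨0, ?_⟩
      rintro d ⟨τ, σ, hτ, hσ, h1, -, -, rfl⟩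
      have := Real.log_nonpos (by positivity) h1.le
      linarith
    · have := Real.log_le_log hc (h τ σ hτ hσ hp hq)
      linarith

theorem nonempty_inter_frontier {S D : Set V} (hS : IsPreconnected S)
    (h1 : (S ∩ interior D).Nonempty) (h2 : (S ∩ Dᶜ).Nonempty) : (S ∩ frontier D).Nonempty := by
  by_contra h
  have hmem : ∀ z ∈ S, z ∈ interior D ∨ z ∉ closure D := fun z hz => by
    by_contra! hcon
    exact h ⟨z, hz, hcon.2, hcon.1⟩
  obtain ⟨z, hzS, hz⟩ := h2
  obtain ⟨w, -, hw1, hw2⟩ := hS _ _ isOpen_interior isClosed_closure.isOpen_compl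
    (fun z hz => hmem z hz) h1
    ⟨z, hzS, (hmem z hzS).resolve_left fun hi => hz (interior_subset hi)⟩
  exact hw2 (subset_closure (interior_subset hw1))

theorem exists_sub_smul_mem_frontier {D : Set V} (hD : ∀ z ∈ D, 0 ≤ z 0) {x y : V}
    (hx : x ∈ interior D) (hy : 0 < y 0) : ∃ τ : ℝ, 0 < τ ∧ x - τ • y ∈ frontier D := by
  have hcont : Continuous fun τ : ℝ => x - τ • y := by fun_prop
  have hpre : IsPreconnected ((fun τ : ℝ => x - τ • y) '' Set.Ici 0) :=
    isPreconnected_Ici.image _ hcont.continuousOn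
  -- At this parameter the coordinate `0` is `x 0 - |x 0| - 1 < 0`, outside the half-space.
  have hfar : x - ((|x 0| + 1) / y 0) • y ∉ D := by
    intro h
    have := hD _ h
    simp only [Pi.sub_apply, Pi.smul_apply, smul_eq_mul, div_mul_cancel₀ _ hy.ne'] at this
    linarith [le_abs_self (x 0)]
  obtain ⟨z, ⟨τ, hτ, rfl⟩, hz⟩ := nonempty_inter_frontier hpre ⟨x, ⟨0, by simp, by simp⟩, hx⟩
    ⟨_, ⟨(|x 0| + 1) / y 0, Set.mem_Ici.2 (by positivity), rfl⟩, hfar⟩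
  refine ⟨τ, lt_of_le_of_ne hτ ?_, hz⟩
  rintro rfl
  simp only [zero_smul, sub_zero] at hz
  exact hz.2 hx

theorem pos_of_mem_interior {D : Set V} (hD : ∀ z ∈ D, 0 ≤ z 0) {x : V} (hx : x ∈ interior D) :
    0 < x 0 := by
  have hcont : Continuous fun r : ℝ => x - r • (Pi.single 0 1 : V) := by fun_prop
  have : ∀ᶠ r in 𝓝 (0 : ℝ), x - r • (Pi.single 0 1 : V) ∈ interior D :=
    hcont.continuousAt.eventually (isOpen_interior.mem_nhds (by simpa using hx))
  obtain ⟨r, hr, hr0⟩ := ((this.filter_mono nhdsWithin_le_nhds).and self_mem_nhdsWithin :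
    ∀ᶠ r in 𝓝[>] (0 : ℝ), _ ∧ r ∈ Set.Ioi 0).exists
  have := hD _ (interior_subset hr)
  simp at this hr0
  linarith

/-- Here boundary pairs must exist, as the default value `0` would break a lower bound. The
half-space condition provides them, since the rays `x - τ y` and `y - σ x` must leave `D`. -/
theorem le_hilbertDist {D : Set V} (hD : IsCone D) (hD0 : ∀ z ∈ D, 0 ≤ z 0) {x y : V}
    (hne : ∀ ρ : ℝ, 0 < ρ → x ≠ ρ • y) (hx : x ∈ interior D) (hy : y ∈ interior D)
    {c : ℝ} (hc1 : c < 1)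
    (h : ∀ τ σ : ℝ, 0 < τ → 0 < σ → x - τ • y ∈ closure D → y - σ • x ∈ closure D →
      τ * σ ≤ c) :
    -(1 / 2) * Real.log c ≤ hilbertDist D x y := by
  rw [hilbertDist_eq_sInf_of_isCone hD hne]
  obtain ⟨τ, hτ, h1⟩ := exists_sub_smul_mem_frontier hD0 hx (pos_of_mem_interior hD0 hy)
  obtain ⟨σ, hσ, h2⟩ := exists_sub_smul_mem_frontier hD0 hy (pos_of_mem_interior hD0 hx)
  refine le_csInf ⟨_, τ, σ, hτ, hσ,
    (h τ σ hτ hσ (frontier_subset_closure h1) (frontier_subset_closure h2)).trans_lt hc1,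
    h1, h2, rfl⟩ ?_
  rintro d ⟨τ, σ, hτ, hσ, -, h1, h2, rfl⟩
  have := Real.log_le_log (by positivity)
    (h τ σ hτ hσ (frontier_subset_closure h1) (frontier_subset_closure h2))
  linarith

/-! ### The position of the domain relative to the axis and its endpoints. -/

/-- A strictly convex surface together with a simple closed geodesic and the logarithms of the
eigenvalues of its holonomy. -/
structure IsMarkedSurface (C : Set V) (Γ : Subgroup SL3) (γ : SL3) (t : Fin 3 → ℝ) : Prop where
  surface : IsStrictlyConvexSurface C Γ
  geodesic : IsSimpleClosedGeodesic C Γ γ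
  lt10 : t 1 < t 0
  lt21 : t 2 < t 1
  act_eq : ∀ x i, act γ x i = Real.exp (t i) * x i

variable {C : Set V} {Γ : Subgroup SL3} {γ : SL3} {t : Fin 3 → ℝ}

theorem exists_isMarkedSurface (hS : IsStrictlyConvexSurface C Γ)
    (hγ : IsSimpleClosedGeodesic C Γ γ) : ∃ t, IsMarkedSurface C Γ γ t := by
  obtain ⟨t, h1, h2, h3⟩ := hγ.diagonal
  exact ⟨t, hS, hγ, h1, h2, fun x i => by rw [act, h3, Matrix.mulVec_diagonal]⟩

namespace IsMarkedSurface

theorem act_zpow (H : IsMarkedSurface C Γ γ t) (n : ℤ) (x : V) (i : Fin 3) :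
    act (γ ^ n) x i = Real.exp (n * t i) * x i := by
  have hinv : ∀ x i, act γ⁻¹ x i = Real.exp (-t i) * x i := fun x i => by
    have := H.act_eq (act γ⁻¹ x) i
    rw [act_act_inv] at this
    rw [this, ← mul_assoc, ← Real.exp_add]; simp
  induction n generalizing x with
  | zero => simp
  | succ n ih =>
    rw [zpow_add_one, act_mul, ih, H.act_eq, ← mul_assoc, ← Real.exp_add]
    push_cast; ring_nf
  | pred n ih =>
    rw [zpow_sub_one, act_mul, ih, hinv, ← mul_assoc, ← Real.exp_add]
    push_cast; ring_nf

theorem zpow_mem (H : IsMarkedSurface C Γ γ t) (n : ℤ) : γ ^ n ∈ Γ := Γ.zpow_mem H.geodesic.mem n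

theorem isCone (H : IsMarkedSurface C Γ γ t) : IsCone C := H.surface.cone

theorem add_mem (H : IsMarkedSurface C Γ γ t) {x y : V} (hx : x ∈ C) (hy : y ∈ C) : x + y ∈ C := by
  have := H.isCone _ (H.surface.convex hx hy (a := 1 / 2) (b := 1 / 2) (by norm_num) (by norm_num)
    (by norm_num)) 2 (by norm_num)
  rwa [smul_add, smul_smul, smul_smul, mul_one_div_cancel two_ne_zero, one_smul, one_smul] at this

theorem act_mem (H : IsMarkedSurface C Γ γ t) {g : SL3} (hg : g ∈ Γ) {x : V} (hx : x ∈ C) :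
    act g x ∈ C := by
  rw [← H.surface.invariant g hg]; exact act_mem_translate g hx

theorem act_mem_frontier (H : IsMarkedSurface C Γ γ t) {g : SL3} (hg : g ∈ Γ) {x : V}
    (hx : x ∈ frontier C) : act g x ∈ frontier C := by
  rw [← H.surface.invariant g hg, frontier_translate]; exact act_mem_translate g hx

theorem mem_axis_iff {x : V} : x ∈ axis ↔ 0 < x 0 ∧ x 1 = 0 ∧ 0 < x 2 := Iff.rfl

theorem single_zero_mem_closure_axis {r : ℝ} (hr : 0 < r) :
    (![r, 0, 0] : V) ∈ closure axis := by
  refine mem_closure_of_tendsto (f := fun u : ℝ => (![r, 0, u] : V)) (b := 𝓝[>] 0) ?_ ?_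
  · have : Continuous fun u : ℝ => (![r, 0, u] : V) := by fun_prop
    exact (this.tendsto 0).mono_left nhdsWithin_le_nhds
  · filter_upwards [self_mem_nhdsWithin] with u hu
    exact ⟨hr, rfl, hu⟩

theorem single_two_mem_closure_axis {r : ℝ} (hr : 0 < r) :
    (![0, 0, r] : V) ∈ closure axis := by
  refine mem_closure_of_tendsto (f := fun u : ℝ => (![u, 0, r] : V)) (b := 𝓝[>] 0) ?_ ?_
  · have : Continuous fun u : ℝ => (![u, 0, r] : V) := by fun_prop
    exact (this.tendsto 0).mono_left nhdsWithin_le_nhds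
  · filter_upwards [self_mem_nhdsWithin] with u hu
    exact ⟨hu, rfl, hr⟩

theorem tendsto_exp_mul_neg {c : ℝ} (hc : c < 0) :
    Tendsto (fun n : ℕ => Real.exp (n * c)) atTop (𝓝 0) := by
  refine Real.tendsto_exp_atBot.comp ?_
  exact tendsto_natCast_atTop_atTop.atTop_mul_const_of_neg hc

/-- If `x 0 < 0`, the rescaled iterates `γ ^ n x` converge to a negative multiple of the attracting
point, whose positive multiples lie in the closure of the axis. This contradicts proper convexity.
-/
theorem nonneg_zero (H : IsMarkedSurface C Γ γ t) {x : V} (hx : x ∈ C) : 0 ≤ x 0 := by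
  by_contra! h
  have h1 : (![x 0, 0, 0] : V) ∈ closure C := by
    refine mem_closure_of_tendsto
      (f := fun n : ℕ => Real.exp (-(n * t 0)) • act (γ ^ (n : ℤ)) x) (b := atTop) ?_
      (Eventually.of_forall fun n => H.isCone _ (H.act_mem (H.zpow_mem _) hx) _ (Real.exp_pos _))
    rw [tendsto_pi_nhds]
    intro i
    have e : ∀ n : ℕ, (Real.exp (-(n * t 0)) • act (γ ^ (n : ℤ)) x) i =
        Real.exp (n * (t i - t 0)) * x i := fun n => by
      rw [Pi.smul_apply, smul_eq_mul, H.act_zpow, ← mul_assoc, ← Real.exp_add]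
      push_cast; ring_nf
    simp only [e]
    fin_cases i
    · simp
    · simpa using (tendsto_exp_mul_neg (sub_neg.2 H.lt10)).mul_const (x 1)
    · simpa using (tendsto_exp_mul_neg (sub_neg.2 (H.lt21.trans H.lt10))).mul_const (x 2)
  have h2 : -(![x 0, 0, 0] : V) ∈ closure C := by
    have := closure_mono H.geodesic.axis_subset (single_zero_mem_closure_axis (neg_pos.2 h))
    simpa using this
  have := congrFun (H.surface.proper _ h1 h2) 0
  simp at this
  linarith

theorem nonneg_two (H : IsMarkedSurface C Γ γ t) {x : V} (hx : x ∈ C) : 0 ≤ x 2 := by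
  by_contra! h
  have h1 : (![0, 0, x 2] : V) ∈ closure C := by
    refine mem_closure_of_tendsto
      (f := fun n : ℕ => Real.exp (n * t 2) • act (γ ^ (-n : ℤ)) x) (b := atTop) ?_
      (Eventually.of_forall fun n => H.isCone _ (H.act_mem (H.zpow_mem _) hx) _ (Real.exp_pos _))
    rw [tendsto_pi_nhds]
    intro i
    have e : ∀ n : ℕ, (Real.exp (n * t 2) • act (γ ^ (-n : ℤ)) x) i =
        Real.exp (n * (t 2 - t i)) * x i := fun n => by
      rw [Pi.smul_apply, smul_eq_mul, H.act_zpow, ← mul_assoc, ← Real.exp_add]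
      push_cast; ring_nf
    simp only [e]
    fin_cases i
    · simpa using (tendsto_exp_mul_neg (sub_neg.2 (H.lt21.trans H.lt10))).mul_const (x 0)
    · simpa using (tendsto_exp_mul_neg (sub_neg.2 H.lt21)).mul_const (x 1)
    · simp
  have h2 : -(![0, 0, x 2] : V) ∈ closure C := by
    have := closure_mono H.geodesic.axis_subset (single_two_mem_closure_axis (neg_pos.2 h))
    simpa using this
  have := congrFun (H.surface.proper _ h1 h2) 2
  simp at this
  linarith

theorem exists_sub_smul_mem {U : Set V} (hU : IsOpen U) {x : V} (hx : x ∈ U) (v : V) :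
    ∃ δ : ℝ, 0 < δ ∧ ∀ r : ℝ, |r| ≤ δ → x - r • v ∈ U := by
  have hcont : Continuous fun r : ℝ => x - r • v := by fun_prop
  have : ∀ᶠ r in 𝓝 (0 : ℝ), x - r • v ∈ U :=
    hcont.continuousAt.eventually (hU.mem_nhds (by simpa using hx))
  obtain ⟨δ, hδ, h⟩ := Metric.eventually_nhds_iff.1 this
  refine ⟨δ / 2, by positivity, fun r hr => h ?_⟩
  rw [Real.dist_eq, sub_zero]; linarith

theorem pos_zero (H : IsMarkedSurface C Γ γ t) {x : V} (hx : x ∈ C) : 0 < x 0 := by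
  obtain ⟨δ, hδ, h⟩ := exists_sub_smul_mem H.surface.isOpen hx (Pi.single 0 1)
  have := H.nonneg_zero (h δ (abs_of_pos hδ).le)
  simp at this
  linarith

theorem pos_two (H : IsMarkedSurface C Γ γ t) {x : V} (hx : x ∈ C) : 0 < x 2 := by
  obtain ⟨δ, hδ, h⟩ := exists_sub_smul_mem H.surface.isOpen hx (Pi.single 2 1)
  have := H.nonneg_two (h δ (abs_of_pos hδ).le)
  simp at this
  linarith

theorem nonneg_of_mem_closure (H : IsMarkedSurface C Γ γ t) {x : V} (hx : x ∈ closure C) :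
    0 ≤ x 0 ∧ 0 ≤ x 2 := by
  have hcl : IsClosed {x : V | 0 ≤ x 0 ∧ 0 ≤ x 2} :=
    (isClosed_le continuous_const (continuous_apply 0)).inter
      (isClosed_le continuous_const (continuous_apply 2))
  have hsub : C ⊆ {x : V | 0 ≤ x 0 ∧ 0 ≤ x 2} := fun x hx => ⟨H.nonneg_zero hx, H.nonneg_two hx⟩
  exact closure_minimal hsub hcl hx

theorem mem_axis (H : IsMarkedSurface C Γ γ t) {x : V} (hx : x ∈ C) (h : x 1 = 0) : x ∈ axis :=
  ⟨H.pos_zero hx, h, H.pos_two hx⟩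

theorem mem_frontier (H : IsMarkedSurface C Γ γ t) {x : V} (hx : x ∈ closure C) (h : x ∉ C) :
    x ∈ frontier C := by
  rw [H.surface.isOpen.frontier_eq]; exact ⟨hx, h⟩

theorem not_mem_of_mem_frontier (H : IsMarkedSurface C Γ γ t) {x : V} (hx : x ∈ frontier C) :
    x ∉ C := by
  rw [H.surface.isOpen.frontier_eq] at hx; exact hx.2

theorem single_zero_mem_frontier (H : IsMarkedSurface C Γ γ t) :
    (![1, 0, 0] : V) ∈ frontier C :=
  H.mem_frontier (closure_mono H.geodesic.axis_subset (single_zero_mem_closure_axis one_pos))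
    fun h => by simpa using H.pos_two h

theorem single_two_mem_frontier (H : IsMarkedSurface C Γ γ t) :
    (![0, 0, 1] : V) ∈ frontier C :=
  H.mem_frontier (closure_mono H.geodesic.axis_subset (single_two_mem_closure_axis one_pos))
    fun h => by simpa using H.pos_zero h

/-- The line `x₂ = 0` touches the domain only at the attracting point: with a second boundary point
on it, strict convexity would put the sum in `C`, where `x₂ > 0`. -/
theorem one_eq_zero_of_two_eq_zero (H : IsMarkedSurface C Γ γ t) {x : V} (hx : x ∈ closure C)
    (h : x 2 = 0) : x 1 = 0 := by
  have hf := H.mem_frontier hx fun h' => (H.pos_two h').ne' h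
  by_contra h1
  refine absurd (H.pos_two (H.surface.strict _ hf _ H.single_zero_mem_frontier ?_)) ?_
  · rintro (h' | h' | ⟨r₁, r₂, h1', h2', h'⟩)
    · exact h1 (congrFun h' 1)
    · simpa using congrFun h' 0
    · have := congrFun h' 1
      simp [h1'.ne', h1] at this
  · simp [h]

theorem one_eq_zero_of_zero_eq_zero (H : IsMarkedSurface C Γ γ t) {x : V} (hx : x ∈ closure C)
    (h : x 0 = 0) : x 1 = 0 := by
  have hf := H.mem_frontier hx fun h' => (H.pos_zero h').ne' h
  by_contra h1
  refine absurd (H.pos_zero (H.surface.strict _ hf _ H.single_two_mem_frontier ?_)) ?_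
  · rintro (h' | h' | ⟨r₁, r₂, h1', h2', h'⟩)
    · exact h1 (congrFun h' 1)
    · simpa using congrFun h' 2
    · have := congrFun h' 1
      simp [h1'.ne', h1] at this
  · simp [h]

theorem pos_of_mem_closure (H : IsMarkedSurface C Γ γ t) {x : V} (hx : x ∈ closure C)
    (h : x 1 ≠ 0) : 0 < x 0 ∧ 0 < x 2 := by
  obtain ⟨h0, h2⟩ := H.nonneg_of_mem_closure hx
  exact ⟨h0.lt_of_ne' fun h' => h (H.one_eq_zero_of_zero_eq_zero hx h'),
    h2.lt_of_ne' fun h' => h (H.one_eq_zero_of_two_eq_zero hx h')⟩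

theorem exists_mem (H : IsMarkedSurface C Γ γ t) :
    ∃ δ : ℝ, 0 < δ ∧ ∀ r : ℝ, |r| ≤ δ → (![1, r, 1] : V) ∈ C := by
  have h0 : (![1, 0, 1] : V) ∈ C := H.geodesic.axis_subset ⟨by simp, by simp, by simp⟩
  obtain ⟨δ, hδ, h⟩ := exists_sub_smul_mem H.surface.isOpen h0 (Pi.single 1 1)
  refine ⟨δ, hδ, fun r hr => ?_⟩
  have := h (-r) (by rwa [abs_neg])
  convert this using 1
  funext i; fin_cases i <;> simp

/-- A neighbourhood of a fundamental interval of the axis. -/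
theorem exists_Icc_subset (H : IsMarkedSurface C Γ γ t) (l : ℝ) :
    ∃ ε : ℝ, 0 < ε ∧ Set.Icc (![1, -ε, 1] : V) ![l, ε, 1] ⊆ C := by
  obtain ⟨δ, hδ, h⟩ := H.exists_mem
  refine ⟨δ / 2, by positivity, fun x hx => ?_⟩
  obtain ⟨hx1, hx2⟩ := hx
  have a0 := hx1 0
  have a1 := hx1 1
  have a2 := hx1 2
  have b1 := hx2 1
  have b2 := hx2 2
  simp at a0 a1 a2 b1 b2
  -- The point is the midpoint of `(1, 2 x₁, 1)`, close to the axis, and of `(2 x₀ - 1, 0, 1)`, on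
  -- the axis.
  have m1 := h (2 * x 1) (by rw [abs_le]; constructor <;> linarith)
  have m2 : (![2 * x 0 - 1, 0, 1] : V) ∈ C :=
    H.geodesic.axis_subset ⟨by simp; linarith, by simp, by simp⟩
  have := H.isCone _ (H.add_mem m1 m2) (1 / 2) (by norm_num)
  convert this using 1
  funext i; fin_cases i
  · simp
  · simp
  · simp; linarith

/-! ### A collar of the axis: cocompactness under `γ` and discreteness of the lifts. -/

/-- Every point can be moved by a power of `γ` over a fixed fundamental interval of the axis. -/
theorem exists_zpow (H : IsMarkedSurface C Γ γ t) {x : V} (h0 : 0 < x 0) (h2 : 0 < x 2) :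
    ∃ n : ℤ, act (γ ^ n) x 2 ≤ act (γ ^ n) x 0 ∧
      act (γ ^ n) x 0 ≤ Real.exp (t 0 - t 2) * act (γ ^ n) x 2 := by
  have hpos : 0 < t 0 - t 2 := by linarith [H.lt10, H.lt21]
  -- `γ ^ n` multiplies `x 0 / x 2` by `exp (n (t 0 - t 2))`, so this is the least `n` that makes
  -- the ratio at least `1`.
  set n := ⌈Real.log (x 2 / x 0) / (t 0 - t 2)⌉ with hn
  have n1 : Real.log (x 2 / x 0) / (t 0 - t 2) ≤ n := Int.le_ceil _
  have n2 : (n : ℝ) < Real.log (x 2 / x 0) / (t 0 - t 2) + 1 := Int.ceil_lt_add_one _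
  rw [div_le_iff₀ hpos, Real.log_div h2.ne' h0.ne'] at n1
  rw [div_add_one hpos.ne', lt_div_iff₀ hpos, Real.log_div h2.ne' h0.ne'] at n2
  refine ⟨n, ?_, ?_⟩
  · rw [H.act_zpow, H.act_zpow, ← Real.exp_log h2, ← Real.exp_log h0, ← Real.exp_add,
      ← Real.exp_add, Real.exp_le_exp]
    linarith
  · rw [H.act_zpow, H.act_zpow, ← Real.exp_log h2, ← Real.exp_log h0, ← Real.exp_add,
      ← Real.exp_add, ← Real.exp_add, Real.exp_le_exp]
    linarith

theorem finite_of_isCompact (H : IsMarkedSurface C Γ γ t) {J K : Set V} (hJ : IsCompact J)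
    (hK : IsCompact K) (hJC : J ⊆ C) (hKC : K ⊆ C) :
    {g : SL3 | g ∈ Γ ∧ ∃ x ∈ J, ∃ r : ℝ, 0 < r ∧ r • act g x ∈ K}.Finite := by
  refine (H.surface.properlyDiscontinuous (J ∪ K) (Set.union_subset hJC hKC) (hJ.union hK)).subset ?_
  rintro g ⟨hg, x, hx, r, hr, h⟩
  exact ⟨hg, x, Or.inl hx, r, hr, Or.inr h⟩

theorem exists_pos_forall_one_le (H : IsMarkedSurface C Γ γ t) {J : Set V} (hJ : IsCompact J)
    (hJC : J ⊆ C) {g : SL3} (hg : g ∈ Γ)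
    (h : (∀ j ∈ J, act g j 1 = 0) ∨ (∀ j ∈ J, act g j 1 ≠ 0)) :
    ∃ δ : ℝ, 0 < δ ∧ ∀ j ∈ J, act g j 1 = 0 ∨ δ * act g j 2 ≤ |act g j 1| := by
  rcases h with h | h
  · exact ⟨1, one_pos, fun j hj => Or.inl (h j hj)⟩
  rcases J.eq_empty_or_nonempty with rfl | hne
  · exact ⟨1, one_pos, by simp⟩
  have hp : ∀ j ∈ J, 0 < act g j 2 := fun j hj => H.pos_two (H.act_mem hg (hJC hj))
  have hc : ContinuousOn (fun j => |act g j 1| / act g j 2) J := by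
    have h1 := (continuous_apply (1 : Fin 3)).comp (continuous_act g)
    have h2 := (continuous_apply (2 : Fin 3)).comp (continuous_act g)
    exact h1.abs.continuousOn.div h2.continuousOn fun j hj => (hp j hj).ne'
  obtain ⟨j, hj, hmin⟩ := hJ.exists_isMinOn hne hc
  refine ⟨|act g j 1| / act g j 2, div_pos (abs_pos.2 (h j hj)) (hp j hj), fun k hk => Or.inr ?_⟩
  rw [← le_div_iff₀ (hp k hk)]
  exact hmin hk

/-- The orbit of a compact set stays away from the axis, in a sense that is invariant under `γ`,
except for the translates contained in the axis. -/
theorem exists_orbit_deep (H : IsMarkedSurface C Γ γ t) {J : Set V} (hJ : IsCompact J) (hJC : J ⊆ C)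
    (h : ∀ g ∈ Γ, (∀ j ∈ J, act g j 1 = 0) ∨ (∀ j ∈ J, act g j 1 ≠ 0)) :
    ∃ ε : ℝ, 0 < ε ∧ ∀ g ∈ Γ, ∀ j ∈ J,
      act g j 1 = 0 ∨ ε * min (act g j 0) (act g j 2) ≤ |act g j 1| := by
  set l := Real.exp (t 0 - t 2) with hl
  have hl1 : 1 ≤ l := Real.one_le_exp (by linarith [H.lt10, H.lt21])
  obtain ⟨ε₀, hε₀, hsub⟩ := H.exists_Icc_subset l
  have hfin := H.finite_of_isCompact hJ isCompact_Icc hJC hsub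
  -- Proper discontinuity leaves finitely many `g` that bring `J` into the block over a fundamental
  -- interval, so one `ε` serves them all.
  have hδ : ∀ g ∈ {g : SL3 | g ∈ Γ ∧ ∃ x ∈ J, ∃ r : ℝ, 0 < r ∧
      r • act g x ∈ Set.Icc (![1, -ε₀, 1] : V) ![l, ε₀, 1]},
      ∀ᶠ ε : ℝ in 𝓝[>] 0, ∀ j ∈ J, act g j 1 = 0 ∨ ε * act g j 2 ≤ |act g j 1| := by
    intro g hg
    obtain ⟨δ, hδ, hδ'⟩ := H.exists_pos_forall_one_le hJ hJC hg.1 (h g hg.1)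
    filter_upwards [Ioo_mem_nhdsGT hδ] with ε hε j hj
    refine (hδ' j hj).imp id fun h' => le_trans ?_ h'
    have := H.pos_two (H.act_mem hg.1 (hJC hj))
    exact mul_le_mul_of_nonneg_right hε.2.le this.le
  obtain ⟨ε, hε, hε1, hε0⟩ :=
    (((eventually_all_finite hfin).2 hδ).and (Ioo_mem_nhdsGT hε₀)).exists
  have key : ∀ g ∈ Γ, ∀ j ∈ J, act g j 2 ≤ act g j 0 → act g j 0 ≤ l * act g j 2 →
      act g j 1 = 0 ∨ ε * act g j 2 ≤ |act g j 1| := by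
    intro g hg j hj h1 h2
    have hp := H.pos_two (H.act_mem hg (hJC hj))
    by_cases hs : |act g j 1| ≤ ε₀ * act g j 2
    · refine hε g ⟨hg, j, hj, (act g j 2)⁻¹, inv_pos.2 hp, ?_⟩ j hj
      rw [abs_le] at hs
      constructor <;> intro i <;> fin_cases i <;>
        simp only [Fin.zero_eta, Fin.mk_one, Fin.reduceFinMk, Pi.smul_apply, smul_eq_mul,
          Matrix.cons_val, inv_mul_eq_div, le_div_iff₀ hp, div_le_iff₀ hp] <;> linarith
    · right
      nlinarith [hε0]
  refine ⟨ε / l, by have := hε1; positivity, fun g hg j hj => ?_⟩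
  have hv := H.act_mem hg (hJC hj)
  obtain ⟨n, n1, n2⟩ := H.exists_zpow (H.pos_zero hv) (H.pos_two hv)
  have hk := key (γ ^ n * g) (Γ.mul_mem (H.zpow_mem n) hg) j hj
  simp only [act_mul] at hk
  replace hk := hk n1 n2
  have p2 := H.pos_two hv
  have p0 := H.pos_zero hv
  set v := act g j with hvdef
  simp only [H.act_zpow] at hk n1 n2
  rcases hk with hk | hk
  · left; simpa using hk
  right
  rw [abs_mul, abs_of_pos (Real.exp_pos _)] at hk
  rw [div_mul_eq_mul_div, div_le_iff₀ (by positivity)]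
  -- Undoing `γ ^ n`: since `t 1` lies between `t 2` and `t 0`, the depth is controlled against
  -- coordinate `0` for `n ≥ 0` and against coordinate `2` for `n ≤ 0`. Hence the minimum in the
  -- statement.
  rcases le_total (0 : ℝ) n with hn | hn
  · have e1 : Real.exp (n * t 1) ≤ Real.exp (n * t 0) :=
      Real.exp_le_exp.2 (mul_le_mul_of_nonneg_left H.lt10.le hn)
    have : Real.exp (n * t 0) * (ε * v 0) ≤ Real.exp (n * t 0) * (|v 1| * l) := by
      calc Real.exp (n * t 0) * (ε * v 0) = ε * (Real.exp (n * t 0) * v 0) := by ring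
        _ ≤ ε * (l * (Real.exp (n * t 2) * v 2)) := by gcongr
        _ = l * (ε * (Real.exp (n * t 2) * v 2)) := by ring
        _ ≤ l * (Real.exp (n * t 1) * |v 1|) := by gcongr
        _ ≤ l * (Real.exp (n * t 0) * |v 1|) := by gcongr
        _ = _ := by ring
    calc ε * min (v 0) (v 2) ≤ ε * v 0 := by gcongr; exact min_le_left _ _
      _ ≤ _ := le_of_mul_le_mul_left this (Real.exp_pos _)
  · have e1 : Real.exp (n * t 1) ≤ Real.exp (n * t 2) :=
      Real.exp_le_exp.2 (mul_le_mul_of_nonpos_left H.lt21.le hn)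
    have : Real.exp (n * t 2) * (ε * v 2) ≤ Real.exp (n * t 2) * |v 1| := by
      calc Real.exp (n * t 2) * (ε * v 2) = ε * (Real.exp (n * t 2) * v 2) := by ring
        _ ≤ Real.exp (n * t 1) * |v 1| := hk
        _ ≤ Real.exp (n * t 2) * |v 1| := by gcongr
    calc ε * min (v 0) (v 2) ≤ ε * v 2 := by gcongr; exact min_le_right _ _
      _ ≤ |v 1| := le_of_mul_le_mul_left this (Real.exp_pos _)
      _ ≤ |v 1| * l := le_mul_of_one_le_right (abs_nonneg _) hl1

end IsMarkedSurface

theorem act_e0 (g : SL3) (i : Fin 3) : act g ![1, 0, 0] i = g.1 i 0 := by simp [act_apply]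

theorem act_e2 (g : SL3) (i : Fin 3) : act g ![0, 0, 1] i = g.1 i 2 := by simp [act_apply]

/-- The lift `g axis` lies strictly on the side of `axis` given by the sign of `ς`. -/
def IsOnSide (ς : ℝ) (g : SL3) : Prop := ∀ x ∈ axis, 0 < ς * act g x 1

theorem translate_inv_ne {g : SL3} {X : Set V} (h : translate g X ≠ X) : translate g⁻¹ X ≠ X :=
  fun h' => h (by simpa using translate_inv_eq h')

namespace IsMarkedSurface

theorem exists_smul_mem_Icc (H : IsMarkedSurface C Γ γ t) {x : V} (hx : x ∈ axis) :
    ∃ n : ℤ, ∃ r : ℝ, 0 < r ∧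
      ∃ i ∈ Set.Icc (![1, 0, 1] : V) ![Real.exp (t 0 - t 2), 0, 1], act (γ ^ n) x = r • i := by
  obtain ⟨n, h1, h2⟩ := H.exists_zpow hx.1 hx.2.2
  have hX := H.act_mem (H.zpow_mem n) (H.geodesic.axis_subset hx)
  have p2 := H.pos_two hX
  have e1 : act (γ ^ n) x 1 = 0 := by rw [H.act_zpow, hx.2.1, mul_zero]
  refine ⟨n, act (γ ^ n) x 2, p2, (act (γ ^ n) x 2)⁻¹ • act (γ ^ n) x, ?_, ?_⟩
  · constructor <;> intro i <;> fin_cases i <;>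
      simp only [Fin.zero_eta, Fin.mk_one, Fin.reduceFinMk, Pi.smul_apply, smul_eq_mul,
        Matrix.cons_val, inv_mul_eq_div, le_div_iff₀ p2, div_le_iff₀ p2] <;> linarith
  · rw [smul_inv_smul₀ p2.ne']

theorem Icc_subset_axis (l : ℝ) : Set.Icc (![1, 0, 1] : V) ![l, 0, 1] ⊆ axis := by
  rintro x ⟨h1, h2⟩
  have a0 := h1 0
  have a1 := h1 1
  have a2 := h1 2
  have b1 := h2 1
  simp at a0 a1 a2 b1
  exact ⟨by linarith, by linarith, by linarith⟩

theorem act_one_eq_zero {g : SL3} (h : translate g axis = axis) {x : V} (hx : x ∈ axis) :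
    act g x 1 = 0 := by
  have := act_mem_translate g hx
  rw [h] at this
  exact this.2.1

theorem act_one_ne_zero (H : IsMarkedSurface C Γ γ t) {g : SL3} (hg : g ∈ Γ)
    (h : translate g axis ≠ axis) {x : V} (hx : x ∈ axis) : act g x 1 ≠ 0 := by
  intro h0
  have h1 := H.mem_axis (H.act_mem hg (H.geodesic.axis_subset hx)) h0
  exact Set.disjoint_left.1 ((H.geodesic.simple g hg).resolve_left h) (act_mem_translate g hx) h1

/-- The axis is not compact, but modulo `γ` and scaling it is a compact interval, to which
`exists_orbit_deep` applies; simplicity supplies its dichotomy. -/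
theorem exists_lift_deep (H : IsMarkedSurface C Γ γ t) :
    ∃ ε : ℝ, 0 < ε ∧ ∀ g ∈ Γ, ∀ x ∈ axis,
      act g x 1 = 0 ∨ ε * min (act g x 0) (act g x 2) ≤ |act g x 1| := by
  have hI := Icc_subset_axis (Real.exp (t 0 - t 2))
  obtain ⟨ε, hε, h⟩ := H.exists_orbit_deep
    (J := Set.Icc (![1, 0, 1] : V) ![Real.exp (t 0 - t 2), 0, 1]) isCompact_Icc
    (hI.trans H.geodesic.axis_subset) (fun g hg => by
      by_cases hga : translate g axis = axis
      · exact Or.inl fun j hj => act_one_eq_zero hga (hI hj)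
      · exact Or.inr fun j hj => H.act_one_ne_zero hg hga (hI hj))
  refine ⟨ε, hε, fun g hg x hx => ?_⟩
  obtain ⟨n, r, hr, i, hi, hx'⟩ := H.exists_smul_mem_Icc hx
  have e : act g x = r • act (g * (γ ^ n)⁻¹) i := by
    rw [← act_smul, ← hx', act_mul, act_inv_act]
  have := h (g * (γ ^ n)⁻¹) (Γ.mul_mem hg (Γ.inv_mem (H.zpow_mem n))) i hi
  rw [e]
  simp only [Pi.smul_apply, smul_eq_mul, abs_mul, abs_of_pos hr, ← mul_min_of_nonneg _ _ hr.le]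
  refine this.imp (fun h => by rw [h, mul_zero]) fun h => ?_
  rw [mul_left_comm]
  gcongr

/-- The lifts are locally finite: finitely many meet a compact neighbourhood, and inside `C` each is
the zero set of a linear form. -/
theorem isOpen_diff_lifts (H : IsMarkedSurface C Γ γ t) : IsOpen (C \ lifts Γ) := by
  rw [isOpen_iff_mem_nhds]
  rintro x ⟨hx, hxl⟩
  obtain ⟨N, hN, hNC, hNc⟩ := local_compact_nhds (H.surface.isOpen.mem_nhds hx)
  have hI := Icc_subset_axis (Real.exp (t 0 - t 2))
  have hfin := H.finite_of_isCompact
    (J := Set.Icc (![1, 0, 1] : V) ![Real.exp (t 0 - t 2), 0, 1]) isCompact_Icc hNc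
    (hI.trans H.geodesic.axis_subset) hNC
  have hev : ∀ᶠ y in 𝓝 x, ∀ g ∈ {g : SL3 | g ∈ Γ ∧
      ∃ x ∈ Set.Icc (![1, 0, 1] : V) ![Real.exp (t 0 - t 2), 0, 1],
      ∃ r : ℝ, 0 < r ∧ r • act g x ∈ N}, act g⁻¹ y 1 ≠ 0 := by
    rw [eventually_all_finite hfin]
    intro g hg
    have hc := (continuous_apply (1 : Fin 3)).comp (continuous_act g⁻¹)
    refine hc.continuousAt.eventually_ne fun h => hxl ?_
    have := H.mem_axis (H.act_mem (Γ.inv_mem hg.1) hx) h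
    exact Set.mem_biUnion hg.1 (mem_translate.2 this)
  filter_upwards [hN, hev] with y hyN hy
  refine ⟨hNC hyN, fun hyl => ?_⟩
  obtain ⟨g, hg, hyg⟩ := Set.mem_iUnion₂.1 hyl
  obtain ⟨n, r, hr, i, hi, hx'⟩ := H.exists_smul_mem_Icc (mem_translate.1 hyg)
  have hgn : g * (γ ^ n)⁻¹ ∈ Γ := Γ.mul_mem hg (Γ.inv_mem (H.zpow_mem n))
  have e : y = r • act (g * (γ ^ n)⁻¹) i := by
    rw [← act_smul, ← hx', act_mul, act_inv_act, act_act_inv]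
  refine hy (g * (γ ^ n)⁻¹) ⟨hgn, i, hi, r, hr, e ▸ hyN⟩ ?_
  rw [e, act_smul, act_inv_act, Pi.smul_apply, (hI hi).2.1, smul_zero]

/-- An endpoint `u` of a lift with `u 1 = 0` would be an endpoint of the axis. Points of the lift
converging to `u` then have translates by powers of `γ` arbitrarily close to the axis, against
`exists_lift_deep`. -/
theorem no_common_endpoint_aux (H : IsMarkedSurface C Γ γ t) {g : SL3} (hg : g ∈ Γ)
    (hga : translate g axis ≠ axis) {u v : V} (hu : u ∈ frontier C) (hv : v ∈ closure C)
    (h : ∀ a b : ℝ, 0 < a → 0 < b → ∃ x ∈ axis, act g x = a • u + b • v) (hu0 : u ≠ 0) :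
    u 1 ≠ 0 := by
  intro hu1
  have hv1 : v 1 ≠ 0 := by
    obtain ⟨x, hx, hx'⟩ := h 1 1 one_pos one_pos
    have := H.act_one_ne_zero hg hga hx
    rw [hx'] at this
    simpa [hu1] using this
  obtain ⟨v0, v2⟩ := H.pos_of_mem_closure hv hv1
  obtain ⟨u0, u2⟩ := H.nonneg_of_mem_closure (frontier_subset_closure hu)
  obtain ⟨ε, hε, hd⟩ := H.exists_lift_deep
  rcases u0.eq_or_lt with u0 | u0
  · have u2' : 0 < u 2 := u2.lt_of_ne fun h2 => hu0 <| by
      funext i; fin_cases i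
      · exact u0.symm
      · exact hu1
      · exact h2.symm
    have key : ∀ n : ℕ, ε * v 0 ≤ Real.exp (n * (t 1 - t 0)) * |v 1| := by
      intro n
      -- The coefficient of `u` makes coordinate `2` of the point, after `γ ^ n`, at least its
      -- coordinate `0`, which is `exp (n t₀) v₀`. Its coordinate `1` is only `exp (n t₁) v₁`.
      obtain ⟨x, hx, hx'⟩ := h (Real.exp (n * (t 0 - t 2)) * v 0 / u 2) 1 (by positivity) one_pos
      have h1 := hd (γ ^ (n : ℤ) * g) (Γ.mul_mem (H.zpow_mem _) hg) x hx
      rw [act_mul, hx'] at h1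
      simp only [H.act_zpow, Pi.add_apply, Pi.smul_apply, smul_eq_mul, hu1, ← u0, mul_zero,
        zero_add, one_mul, div_mul_cancel₀ _ u2'.ne', Int.cast_natCast] at h1
      rcases h1 with h1 | h1
      · exact absurd h1 (mul_ne_zero (Real.exp_ne_zero _) hv1)
      rw [abs_mul, Real.abs_exp, min_eq_left] at h1
      · have e : Real.exp (n * (t 1 - t 0)) = Real.exp (n * t 1) / Real.exp (n * t 0) := by
          rw [← Real.exp_sub]; ring_nf
        rw [e, div_mul_eq_mul_div, le_div_iff₀ (Real.exp_pos _)]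
        linarith
      · rw [mul_add, ← mul_assoc, ← Real.exp_add]
        have : (n : ℝ) * t 2 + n * (t 0 - t 2) = n * t 0 := by ring
        rw [this]
        have := Real.exp_pos (n * t 2)
        nlinarith
    have hlim := (tendsto_exp_mul_neg (sub_neg.2 H.lt10)).mul_const (|v 1|)
    have := ge_of_tendsto' hlim key
    rw [zero_mul] at this
    exact absurd this (not_le.2 (by positivity))
  · have u2' : u 2 = 0 := by
      by_contra h2
      exact H.not_mem_of_mem_frontier hu (H.geodesic.axis_subset ⟨u0, hu1, u2.lt_of_ne' h2⟩)
    have key : ∀ n : ℕ, ε * v 2 ≤ Real.exp (n * (t 2 - t 1)) * |v 1| := by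
      intro n
      obtain ⟨x, hx, hx'⟩ := h (Real.exp (n * (t 0 - t 2)) * v 2 / u 0) 1 (by positivity) one_pos
      have h1 := hd (γ ^ (-n : ℤ) * g) (Γ.mul_mem (H.zpow_mem _) hg) x hx
      rw [act_mul, hx'] at h1
      simp only [H.act_zpow, Pi.add_apply, Pi.smul_apply, smul_eq_mul, hu1, u2', mul_zero,
        zero_add, one_mul, div_mul_cancel₀ _ u0.ne', Int.cast_neg, Int.cast_natCast] at h1
      rcases h1 with h1 | h1
      · exact absurd h1 (mul_ne_zero (Real.exp_ne_zero _) hv1)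
      rw [abs_mul, Real.abs_exp, min_eq_right] at h1
      · have e : Real.exp (n * (t 2 - t 1)) = Real.exp (-n * t 1) / Real.exp (-n * t 2) := by
          rw [← Real.exp_sub]; ring_nf
        rw [e, div_mul_eq_mul_div, le_div_iff₀ (Real.exp_pos _)]
        linarith
      · rw [mul_add, ← mul_assoc, ← Real.exp_add]
        have : -(n : ℝ) * t 0 + n * (t 0 - t 2) = -n * t 2 := by ring
        rw [this]
        have := Real.exp_pos (-n * t 0)
        nlinarith
    have hlim := (tendsto_exp_mul_neg (sub_neg.2 H.lt21)).mul_const (|v 1|)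
    have := ge_of_tendsto' hlim key
    rw [zero_mul] at this
    exact absurd this (not_le.2 (by positivity))

theorem act_ne_zero (g : SL3) {x : V} (hx : x ≠ 0) : act g x ≠ 0 := by
  intro h
  apply hx
  have := act_inv_act g x
  rw [h] at this
  rw [← this]
  simp [act]

/-- Two different lifts have no common endpoint. -/
theorem no_common_endpoint (H : IsMarkedSurface C Γ γ t) {g : SL3} (hg : g ∈ Γ)
    (hga : translate g axis ≠ axis) : g.1 1 0 ≠ 0 ∧ g.1 1 2 ≠ 0 := by
  have f0 := H.act_mem_frontier hg H.single_zero_mem_frontier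
  have f2 := H.act_mem_frontier hg H.single_two_mem_frontier
  constructor
  · rw [← act_e0]
    refine H.no_common_endpoint_aux hg hga f0 (frontier_subset_closure f2) (fun a b ha hb => ?_)
      (act_ne_zero g fun h => by simpa using congrFun h 0)
    refine ⟨![a, 0, b], ⟨by simpa, by simp, by simpa⟩, ?_⟩
    rw [← act_smul, ← act_smul, ← act_add]
    congr 1
    funext i; fin_cases i <;> simp
  · rw [← act_e2]
    refine H.no_common_endpoint_aux hg hga f2 (frontier_subset_closure f0) (fun a b ha hb => ?_)
      (act_ne_zero g fun h => by simpa using congrFun h 2)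
    refine ⟨![b, 0, a], ⟨by simpa, by simp, by simpa⟩, ?_⟩
    rw [← act_smul, ← act_smul, ← act_add]
    congr 1
    funext i; fin_cases i <;> simp

/-! ### Sign patterns of group elements and nesting of the triangles. -/

/-- The endpoints of a lift on one side of the axis. -/
theorem columns_pos (H : IsMarkedSurface C Γ γ t) {g : SL3} (hg : g ∈ Γ)
    (hga : translate g axis ≠ axis) {ς : ℝ} (hς : IsOnSide ς g) :
    (0 < g.1 0 0 ∧ 0 < ς * g.1 1 0 ∧ 0 < g.1 2 0) ∧
      (0 < g.1 0 2 ∧ 0 < ς * g.1 1 2 ∧ 0 < g.1 2 2) := by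
  obtain ⟨n0, n2⟩ := H.no_common_endpoint hg hga
  have hς0 : ς ≠ 0 := by
    rintro rfl
    simpa using hς ![1, 0, 1] ⟨by simp, by simp, by simp⟩
  have hcl : IsClosed {x : V | 0 ≤ ς * act g x 1} :=
    isClosed_le continuous_const
      (continuous_const.mul ((continuous_apply (1 : Fin 3)).comp (continuous_act g)))
  have hsub : closure axis ⊆ {x : V | 0 ≤ ς * act g x 1} :=
    closure_minimal (fun x hx => (hς x hx).le) hcl
  have s0 := hsub (single_zero_mem_closure_axis one_pos)
  have s2 := hsub (single_two_mem_closure_axis one_pos)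
  simp only [Set.mem_ofPred_eq, act_e0, act_e2] at s0 s2
  have p0 := H.pos_of_mem_closure (frontier_subset_closure
    (H.act_mem_frontier hg H.single_zero_mem_frontier)) (by rwa [act_e0])
  have p2 := H.pos_of_mem_closure (frontier_subset_closure
    (H.act_mem_frontier hg H.single_two_mem_frontier)) (by rwa [act_e2])
  simp only [act_e0, act_e2] at p0 p2
  exact ⟨⟨p0.1, s0.lt_of_ne' (mul_ne_zero hς0 n0), p0.2⟩,
    ⟨p2.1, s2.lt_of_ne' (mul_ne_zero hς0 n2), p2.2⟩⟩

/-- The off-diagonal entries of `g * g⁻¹ = 1` vanish. The outer columns of both factors have known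
signs by `columns_pos`, so the one remaining term in each such entry has a forced sign. -/
theorem middle_column (H : IsMarkedSurface C Γ γ t) {g : SL3} (hg : g ∈ Γ)
    (hga : translate g axis ≠ axis) {ς ς' : ℝ} (hς : IsOnSide ς g) (hς' : IsOnSide ς' g⁻¹) :
    0 < -ς' * g.1 0 1 ∧ 0 < -(ς' * ς) * g.1 1 1 ∧ 0 < -ς' * g.1 2 1 := by
  obtain ⟨⟨a0, a1, a2⟩, b0, b1, b2⟩ := H.columns_pos hg hga hς
  obtain ⟨⟨c0, c1, c2⟩, d0, d1, d2⟩ := H.columns_pos (Γ.inv_mem hg) (translate_inv_ne hga) hς'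
  have h1 : act g (act g⁻¹ ![1, 0, 0]) 1 = 0 := by rw [act_act_inv]; simp
  have h2 : act g (act g⁻¹ ![1, 0, 0]) 2 = 0 := by rw [act_act_inv]; simp
  have h3 : act g (act g⁻¹ ![0, 0, 1]) 0 = 0 := by rw [act_act_inv]; simp
  simp only [act_apply g, act_e0, act_e2] at h1 h2 h3
  set x := (g⁻¹).1
  refine ⟨?_, ?_, ?_⟩
  · have e : -ς' * g.1 0 1 * (ς' * x 1 2) = ς' ^ 2 * (g.1 0 0 * x 0 2 + g.1 0 2 * x 2 2) := by
      linear_combination (-ς' ^ 2) * h3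
    have hς0 : ς' ≠ 0 := by rintro rfl; simp at d1
    have : 0 < -ς' * g.1 0 1 * (ς' * x 1 2) := by rw [e]; positivity
    exact pos_of_mul_pos_left this d1.le
  · have e : -(ς' * ς) * g.1 1 1 * (ς' * x 1 0) =
        ς' ^ 2 * (ς * g.1 1 0 * x 0 0 + ς * g.1 1 2 * x 2 0) := by
      linear_combination (-ς' ^ 2 * ς) * h1
    have hς0 : ς' ≠ 0 := by rintro rfl; simp at d1
    have : 0 < -(ς' * ς) * g.1 1 1 * (ς' * x 1 0) := by rw [e]; positivity
    exact pos_of_mul_pos_left this c1.le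
  · have e : -ς' * g.1 2 1 * (ς' * x 1 0) = ς' ^ 2 * (g.1 2 0 * x 0 0 + g.1 2 2 * x 2 0) := by
      linear_combination (-ς' ^ 2) * h2
    have hς0 : ς' ≠ 0 := by rintro rfl; simp at d1
    have : 0 < -ς' * g.1 2 1 * (ς' * x 1 0) := by rw [e]; positivity
    exact pos_of_mul_pos_left this c1.le

end IsMarkedSurface

/-- The closed cone over the triangle cut out by the tangents at the endpoints of the axis, on the
side of the axis given by the sign of `ς`. -/
def closedTriangle (ς : ℝ) : Set V := {x | 0 ≤ x 0 ∧ 0 ≤ ς * x 1 ∧ 0 ≤ x 2}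

/-- The open cone over the triangle cut out by the tangents at the endpoints of the axis, on the
side of the axis given by the sign of `ς`. -/
def openTriangle (ς : ℝ) : Set V := {x | 0 < x 0 ∧ 0 < ς * x 1 ∧ 0 < x 2}

namespace IsMarkedSurface

/-- The nesting behind the ping-pong. The axis lies on the `ς'` side of the lift `g axis`, so `g`
carries the triangle of `-ς'` to the far side of that lift. In the signed coordinates of the two
triangles `g` has positive entries. -/
theorem act_mem_closedTriangle (H : IsMarkedSurface C Γ γ t) {g : SL3} (hg : g ∈ Γ)
    (hga : translate g axis ≠ axis) {ς ς' : ℝ} (hς : IsOnSide ς g) (hς' : IsOnSide ς' g⁻¹)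
    (hsq : ς' ^ 2 = 1) {x : V} (hx : x ∈ closedTriangle (-ς')) : act g x ∈ closedTriangle ς := by
  obtain ⟨⟨a0, a1, a2⟩, b0, b1, b2⟩ := H.columns_pos hg hga hς
  obtain ⟨m0, m1, m2⟩ := H.middle_column hg hga hς hς'
  obtain ⟨x0, x1, x2⟩ := hx
  refine ⟨?_, ?_, ?_⟩ <;> rw [act_apply]
  · have : g.1 0 0 * x 0 + g.1 0 1 * x 1 + g.1 0 2 * x 2 =
      g.1 0 0 * x 0 + (-ς' * g.1 0 1) * (-ς' * x 1) + g.1 0 2 * x 2 := by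
      linear_combination (-g.1 0 1 * x 1) * hsq
    rw [this]; positivity
  · have : ς * (g.1 1 0 * x 0 + g.1 1 1 * x 1 + g.1 1 2 * x 2) =
      ς * g.1 1 0 * x 0 + (-(ς' * ς) * g.1 1 1) * (-ς' * x 1) + ς * g.1 1 2 * x 2 := by
      linear_combination (-ς * g.1 1 1 * x 1) * hsq
    rw [this]; positivity
  · have : g.1 2 0 * x 0 + g.1 2 1 * x 1 + g.1 2 2 * x 2 =
      g.1 2 0 * x 0 + (-ς' * g.1 2 1) * (-ς' * x 1) + g.1 2 2 * x 2 := by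
      linear_combination (-g.1 2 1 * x 1) * hsq
    rw [this]; positivity

theorem act_mem_openTriangle (H : IsMarkedSurface C Γ γ t) {g : SL3} (hg : g ∈ Γ)
    (hga : translate g axis ≠ axis) {ς ς' : ℝ} (hς : IsOnSide ς g) (hς' : IsOnSide ς' g⁻¹)
    (hsq : ς' ^ 2 = 1) {x : V} (hx : x ∈ openTriangle (-ς')) : act g x ∈ openTriangle ς := by
  obtain ⟨⟨a0, a1, a2⟩, b0, b1, b2⟩ := H.columns_pos hg hga hς
  obtain ⟨m0, m1, m2⟩ := H.middle_column hg hga hς hς'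
  obtain ⟨x0, x1, x2⟩ := hx
  refine ⟨?_, ?_, ?_⟩ <;> rw [act_apply]
  · have : g.1 0 0 * x 0 + g.1 0 1 * x 1 + g.1 0 2 * x 2 =
      g.1 0 0 * x 0 + (-ς' * g.1 0 1) * (-ς' * x 1) + g.1 0 2 * x 2 := by
      linear_combination (-g.1 0 1 * x 1) * hsq
    rw [this]; positivity
  · have : ς * (g.1 1 0 * x 0 + g.1 1 1 * x 1 + g.1 1 2 * x 2) =
      ς * g.1 1 0 * x 0 + (-(ς' * ς) * g.1 1 1) * (-ς' * x 1) + ς * g.1 1 2 * x 2 := by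
      linear_combination (-ς * g.1 1 1 * x 1) * hsq
    rw [this]; positivity
  · have : g.1 2 0 * x 0 + g.1 2 1 * x 1 + g.1 2 2 * x 2 =
      g.1 2 0 * x 0 + (-ς' * g.1 2 1) * (-ς' * x 1) + g.1 2 2 * x 2 := by
      linear_combination (-g.1 2 1 * x 1) * hsq
    rw [this]; positivity

/-- The triangles over the lifts on the right stay away from the axis. -/
theorem exists_triangle_deep (H : IsMarkedSurface C Γ γ t) :
    ∃ ε : ℝ, 0 < ε ∧ ∀ g ∈ Γ, translate g axis ≠ axis → IsOnSide 1 g →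
      ∀ ς' : ℝ, ς' ^ 2 = 1 → IsOnSide ς' g⁻¹ → ∀ v ∈ openTriangle (-ς'),
        ε * min (act g v 0) (act g v 2) ≤ act g v 1 := by
  obtain ⟨δ, hδ, hδ'⟩ := H.exists_mem
  obtain ⟨ε, hε, hd⟩ := H.exists_lift_deep
  refine ⟨min ε (δ / 2), by positivity, fun g hg hga hς ς' hsq hς' v hv => ?_⟩
  by_contra! hlt
  have hw := H.act_mem_openTriangle hg hga hς hς' hsq hv
  set w := act g v with hwdef
  obtain ⟨w0, w1, w2⟩ := hw
  rw [one_mul] at w1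
  set m := min (w 0) (w 2) with hm
  have hm0 : 0 < m := lt_min w0 w2
  have hm1 : m ≤ w 0 := min_le_left _ _
  have hm2 : m ≤ w 2 := min_le_right _ _
  have hlt1 : w 1 < ε * m := hlt.trans_le (by gcongr; exact min_le_left _ _)
  have hlt2 : w 1 < δ / 2 * m := hlt.trans_le (by gcongr; exact min_le_right _ _)
  -- Too close to the axis, `w` would be a sum of a multiple of `(1, r, 1)` with `r` small and of a
  -- point of the axis.
  have hwC : w ∈ C := by
    have i1 := hδ' (2 * w 1 / m) (by
      rw [abs_of_pos (by positivity), div_le_iff₀ hm0]; linarith)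
    have i2 : (![w 0 - m / 2, 0, w 2 - m / 2] : V) ∈ C :=
      H.geodesic.axis_subset ⟨by simp; linarith, by simp, by simp; linarith⟩
    convert H.add_mem (H.isCone _ i1 (m / 2) (by positivity)) i2 using 1
    funext i; fin_cases i
    · simp
    · simp; field_simp
    · simp
  have hp : (![1, 0, 1] : V) ∈ axis := ⟨by simp, by simp, by simp⟩
  have ha := hς' _ hp
  set a := act g⁻¹ ![1, 0, 1] 1 with hadef
  have hb := hv.2.1
  have hab : a * v 1 < 0 := by nlinarith [mul_pos ha hb]
  have hv1 : v 1 ≠ 0 := by intro h; simp [h] at hb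
  -- The points `(1, 0, 1)` and `w` lie on opposite sides of the lift `g axis`, and the coefficients
  -- pick the crossing point `q` of their segment. It is as shallow as `w`, against
  -- `exists_lift_deep`.
  set q : V := (v 1 ^ 2) • ![1, 0, 1] + (-(a * v 1)) • w with hq
  have hqC : q ∈ C := H.add_mem (H.isCone _ (H.geodesic.axis_subset hp) _ (by positivity))
    (H.isCone _ hwC _ (by linarith))
  have hqa : act g⁻¹ q ∈ axis := by
    refine H.mem_axis (H.act_mem (Γ.inv_mem hg) hqC) ?_
    rw [hq, act_add, act_smul, act_smul, hwdef, act_inv_act]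
    simp only [Pi.add_apply, Pi.smul_apply, smul_eq_mul, ← hadef]
    ring
  have hq0 : q 0 = v 1 ^ 2 + -(a * v 1) * w 0 := by
    simp only [hq, Pi.add_apply, Pi.smul_apply, smul_eq_mul, Matrix.cons_val]; ring
  have hq1 : q 1 = -(a * v 1) * w 1 := by
    simp only [hq, Pi.add_apply, Pi.smul_apply, smul_eq_mul, Matrix.cons_val]; ring
  have hq2 : q 2 = v 1 ^ 2 + -(a * v 1) * w 2 := by
    simp only [hq, Pi.add_apply, Pi.smul_apply, smul_eq_mul, Matrix.cons_val]; ring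
  have hq1' : 0 < q 1 := by rw [hq1]; exact mul_pos (by linarith) w1
  have := hd g hg _ hqa
  rw [act_act_inv, abs_of_pos hq1'] at this
  rcases this with this | this
  · exact hq1'.ne' this
  have hmin : -(a * v 1) * m ≤ min (q 0) (q 2) := by
    have := sq_nonneg (v 1)
    refine le_min ?_ ?_
    · rw [hq0]; nlinarith
    · rw [hq2]; nlinarith
  have h3 := mul_le_mul_of_nonneg_left hmin hε.le
  rw [hq1] at this
  nlinarith

/-! ### The stabiliser of the axis. -/

/-- The stabiliser of the axis consists of diagonal matrices with positive entries. -/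
theorem stabilizer_diagonal (H : IsMarkedSurface C Γ γ t) {d : SL3} (hd : d ∈ Γ)
    (hda : translate d axis = axis) :
    ∃ c : Fin 3 → ℝ, (∀ i, 0 < c i) ∧ ∀ x i, act d x i = c i * x i := by
  have hcl : ∀ x ∈ closure axis, 0 ≤ act d x 0 ∧ act d x 1 = 0 ∧ 0 ≤ act d x 2 := by
    intro x hx
    have h1 : act d x ∈ closure axis := by
      rw [← hda, closure_translate]; exact act_mem_translate d hx
    have hcl : IsClosed {x : V | 0 ≤ x 0 ∧ x 1 = 0 ∧ 0 ≤ x 2} :=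
      (isClosed_le continuous_const (continuous_apply 0)).inter
        ((isClosed_eq (continuous_apply 1) continuous_const).inter
        (isClosed_le continuous_const (continuous_apply 2)))
    have hsub : axis ⊆ {x : V | 0 ≤ x 0 ∧ x 1 = 0 ∧ 0 ≤ x 2} :=
      fun x hx => ⟨hx.1.le, hx.2.1, hx.2.2.le⟩
    exact closure_minimal hsub hcl h1
  obtain ⟨a0, a1, a2⟩ := hcl _ (single_zero_mem_closure_axis one_pos)
  obtain ⟨b0, b1, b2⟩ := hcl _ (single_two_mem_closure_axis one_pos)
  have fa : d.1 0 0 = 0 ∨ d.1 2 0 = 0 := by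
    by_contra! h
    refine H.not_mem_of_mem_frontier (H.act_mem_frontier hd H.single_zero_mem_frontier)
      (H.geodesic.axis_subset ⟨a0.lt_of_ne' ?_, a1, a2.lt_of_ne' ?_⟩) <;> rw [act_e0]
    exacts [h.1, h.2]
  have fb : d.1 0 2 = 0 ∨ d.1 2 2 = 0 := by
    by_contra! h
    refine H.not_mem_of_mem_frontier (H.act_mem_frontier hd H.single_two_mem_frontier)
      (H.geodesic.axis_subset ⟨b0.lt_of_ne' ?_, b1, b2.lt_of_ne' ?_⟩) <;> rw [act_e2]
    exacts [h.1, h.2]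
  rw [act_e0] at a0 a1 a2
  rw [act_e2] at b0 b1 b2
  have hdet := d.2
  rw [Matrix.det_fin_three, a1, b1] at hdet
  -- An element exchanging the two endpoints would fix a point of the axis, which freeness excludes.
  have hswap : d.1 0 0 ≠ 0 := by
    intro h00
    rw [h00] at hdet
    have p2 : 0 < d.1 2 0 := a2.lt_of_ne' fun h => by simp [h] at hdet
    have p0 : 0 < d.1 0 2 := b0.lt_of_ne' fun h => by simp [h] at hdet
    have h22 : d.1 2 2 = 0 := fb.resolve_left p0.ne'
    have hfix := H.surface.free d hd ![√(d.1 0 2), 0, √(d.1 2 0)]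
      (H.geodesic.axis_subset ⟨by simpa, by simp, by simpa⟩) (√(d.1 0 2) * √(d.1 2 0))
      (by positivity) (by
        have s0 := Real.mul_self_sqrt p0.le
        have s2 := Real.mul_self_sqrt p2.le
        funext i
        rw [act_apply]
        fin_cases i
        · simp [h00]; linear_combination (-√(d.1 2 0)) * s0
        · simp [a1, b1]
        · simp [h22]; linear_combination (-√(d.1 0 2)) * s2)
    rw [hfix] at h00
    simp at h00
  have h20 : d.1 2 0 = 0 := fa.resolve_left hswap
  have p00 : 0 < d.1 0 0 := a0.lt_of_ne' hswap
  rw [h20] at hdet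
  have p22 : 0 < d.1 2 2 := b2.lt_of_ne' fun h => by simp [h] at hdet
  have h02 : d.1 0 2 = 0 := fb.resolve_right p22.ne'
  rw [h02] at hdet
  have hdet' : d.1 0 0 * d.1 1 1 * d.1 2 2 = 1 := by linarith
  have p11 : 0 < d.1 1 1 := by
    have h1 : 0 < d.1 1 1 * (d.1 0 0 * d.1 2 2) := by
      rw [show d.1 1 1 * (d.1 0 0 * d.1 2 2) = 1 by linarith]; exact one_pos
    exact pos_of_mul_pos_left h1 (by positivity)
  obtain ⟨δ, hδ, hδ'⟩ := H.exists_mem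
  -- Positivity of coordinate `2` of `d γⁿ (1, ς, 1)`, divided by `exp (n t₁)`, gives `d₂₁ ς ≥ 0` in
  -- the limit. Both signs of `ς` are allowed, so `d₂₁ = 0`; negative powers treat `d₀₁`.
  have k2 : ∀ ς : ℝ, |ς| ≤ δ → 0 ≤ d.1 2 1 * ς := by
    intro ς hς
    have key : ∀ n : ℕ, -(Real.exp (n * (t 2 - t 1)) * d.1 2 2) ≤ d.1 2 1 * ς := by
      intro n
      have h1 := H.pos_two (H.act_mem hd (H.act_mem (H.zpow_mem n) (hδ' ς hς)))
      rw [act_apply, h20] at h1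
      simp only [H.act_zpow] at h1
      simp at h1
      have e : Real.exp (n * (t 2 - t 1)) = Real.exp (n * t 2) / Real.exp (n * t 1) := by
        rw [← Real.exp_sub]; ring_nf
      rw [e, div_mul_eq_mul_div, ← neg_div, div_le_iff₀ (Real.exp_pos _)]
      linarith
    have hlim := ((tendsto_exp_mul_neg (sub_neg.2 H.lt21)).mul_const (d.1 2 2)).neg
    rw [zero_mul, neg_zero] at hlim
    exact le_of_tendsto' hlim key
  have k0 : ∀ ς : ℝ, |ς| ≤ δ → 0 ≤ d.1 0 1 * ς := by
    intro ς hς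
    have key : ∀ n : ℕ, -(Real.exp (n * (t 1 - t 0)) * d.1 0 0) ≤ d.1 0 1 * ς := by
      intro n
      have h1 := H.pos_zero (H.act_mem hd (H.act_mem (H.zpow_mem (-n)) (hδ' ς hς)))
      rw [act_apply, h02] at h1
      simp only [H.act_zpow] at h1
      simp at h1
      have e : Real.exp (n * (t 1 - t 0)) = Real.exp (-(n * t 0)) / Real.exp (-(n * t 1)) := by
        rw [← Real.exp_sub]; ring_nf
      rw [e, div_mul_eq_mul_div, ← neg_div, div_le_iff₀ (Real.exp_pos _)]
      linarith
    have hlim := ((tendsto_exp_mul_neg (sub_neg.2 H.lt10)).mul_const (d.1 0 0)).neg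
    rw [zero_mul, neg_zero] at hlim
    exact le_of_tendsto' hlim key
  have e21 : d.1 2 1 = 0 := by
    have h1 := k2 δ (abs_of_pos hδ).le
    have h2 := k2 (-δ) (by rw [abs_neg]; exact (abs_of_pos hδ).le)
    have : d.1 2 1 * δ = 0 := by linarith
    exact (mul_eq_zero.1 this).resolve_right hδ.ne'
  have e01 : d.1 0 1 = 0 := by
    have h1 := k0 δ (abs_of_pos hδ).le
    have h2 := k0 (-δ) (by rw [abs_neg]; exact (abs_of_pos hδ).le)
    have : d.1 0 1 * δ = 0 := by linarith
    exact (mul_eq_zero.1 this).resolve_right hδ.ne'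
  refine ⟨fun i => d.1 i i, fun i => ?_, fun x i => ?_⟩
  · fin_cases i
    exacts [p00, p11, p22]
  · rw [act_apply]
    fin_cases i
    · simp [e01, h02]
    · simp [a1, b1]
    · simp [e21, h20]

theorem commute_bulge (H : IsMarkedSurface C Γ γ t) {d : SL3} (hd : d ∈ Γ)
    (hda : translate d axis = axis) (s : ℝ) : bulge s * d = d * bulge s := by
  obtain ⟨c, -, hc⟩ := H.stabilizer_diagonal hd hda
  refine SL3.ext_act fun x => ?_
  rw [act_mul, act_mul]
  funext i
  rw [hc]
  fin_cases i
  · simp only [Fin.zero_eta, act_bulge_zero, hc]; ring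
  · simp only [Fin.mk_one, act_bulge_one, hc]; ring
  · simp only [Fin.reduceFinMk, act_bulge_two, hc]; ring

end IsMarkedSurface

/-! ### The regions adjacent to the axis. -/

/-- The sign of the second coordinate on the left (`false`) and on the right (`true`) of the
axis. -/
def side : Bool → ℝ
  | true => 1
  | false => -1

theorem side_not (σ : Bool) : side (!σ) = -side σ := by cases σ <;> simp [side]

theorem side_sq (σ : Bool) : side σ ^ 2 = 1 := by cases σ <;> simp [side]

/-- The component of the complement of the lifts that is adjacent to the axis on the given side. -/
def region (C : Set V) (Γ : Subgroup SL3) (σ : Bool) : Set V :=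
  {x | x ∈ C \ lifts Γ ∧ 0 < side σ * x 1 ∧ axis ⊆ closure (connectedComponentIn (C \ lifts Γ) x)}

theorem region_true : region C Γ true = regionRight C Γ := by
  simp [region, regionRight, side]

theorem region_false : region C Γ false = regionLeft C Γ := by
  simp [region, regionLeft, side]

theorem isCone_axis : IsCone axis := fun x hx r hr =>
  ⟨mul_pos hr hx.1, by simp [hx.2.1], mul_pos hr hx.2.2⟩

theorem IsCone.translate {D : Set V} (h : IsCone D) (g : SL3) : IsCone (translate g D) := by
  rintro _ ⟨x, hx, rfl⟩ r hr
  rw [← act_smul]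
  exact act_mem_translate g (h x hx r hr)

theorem isCone_lifts : IsCone (lifts Γ) := by
  intro x hx r hr
  obtain ⟨g, hg, hxg⟩ := Set.mem_iUnion₂.1 hx
  exact Set.mem_biUnion hg (isCone_axis.translate g x hxg r hr)

theorem act_mem_lifts {g : SL3} (hg : g ∈ Γ) {x : V} (hx : x ∈ lifts Γ) : act g x ∈ lifts Γ := by
  obtain ⟨h, hh, hxh⟩ := Set.mem_iUnion₂.1 hx
  refine Set.mem_biUnion (Γ.mul_mem hg hh) ?_
  rw [translate_mul]
  exact act_mem_translate g hxh

theorem act_mem_lifts_iff {g : SL3} (hg : g ∈ Γ) {x : V} : act g x ∈ lifts Γ ↔ x ∈ lifts Γ :=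
  ⟨fun h => by simpa using act_mem_lifts (Γ.inv_mem hg) h, act_mem_lifts hg⟩

theorem axis_subset_lifts : axis ⊆ lifts Γ := fun x hx =>
  Set.mem_biUnion Γ.one_mem (by simpa using hx)

theorem homeomorph_mem_region {f : V ≃ₜ V} (hf : f '' (C \ lifts Γ) = C \ lifts Γ)
    (hax : f '' axis = axis) {σ : Bool} {x : V} (hs : 0 < side σ * x 1 → 0 < side σ * f x 1)
    (hx : x ∈ region C Γ σ) : f x ∈ region C Γ σ := by
  obtain ⟨h1, h2, h3⟩ := hx
  refine ⟨hf ▸ Set.mem_image_of_mem f h1, hs h2, ?_⟩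
  rw [← hf, ← f.image_connectedComponentIn h1, ← f.image_closure, ← hax]
  exact Set.image_mono h3

namespace IsMarkedSurface

theorem isCone_diff_lifts (H : IsMarkedSurface C Γ γ t) : IsCone (C \ lifts Γ) :=
  fun x hx r hr => ⟨H.isCone x hx.1 r hr, fun h => hx.2 (by
    have := isCone_lifts _ h r⁻¹ (inv_pos.2 hr)
    rwa [inv_smul_smul₀ hr.ne'] at this)⟩

theorem isCone_region (H : IsMarkedSurface C Γ γ t) (σ : Bool) : IsCone (region C Γ σ) := by
  intro x hx r hr
  refine homeomorph_mem_region (f := scaleHomeomorph r hr) (H.isCone_diff_lifts.image_scale r hr)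
    (isCone_axis.image_scale r hr) (fun h => ?_) hx
  rw [coe_scaleHomeomorph, Pi.smul_apply, smul_eq_mul, mul_left_comm]
  positivity

theorem translate_diff_lifts (H : IsMarkedSurface C Γ γ t) {g : SL3} (hg : g ∈ Γ) :
    translate g (C \ lifts Γ) = C \ lifts Γ := by
  ext x
  rw [mem_translate]
  have h1 : act g⁻¹ x ∈ C ↔ x ∈ C := by
    rw [← mem_translate, H.surface.invariant g hg]
  simp only [Set.mem_sdiff, h1, act_mem_lifts_iff (Γ.inv_mem hg)]

theorem act_mem_region (H : IsMarkedSurface C Γ γ t) {d : SL3} (hd : d ∈ Γ)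
    (hda : translate d axis = axis) {σ : Bool} {x : V} (hx : x ∈ region C Γ σ) :
    act d x ∈ region C Γ σ := by
  obtain ⟨c, hc0, hc⟩ := H.stabilizer_diagonal hd hda
  refine homeomorph_mem_region (f := actHomeomorph d) (H.translate_diff_lifts hd) hda
    (fun h => ?_) hx
  rw [coe_actHomeomorph, hc, mul_left_comm]
  exact mul_pos (hc0 1) h

theorem translate_region (H : IsMarkedSurface C Γ γ t) {d : SL3} (hd : d ∈ Γ)
    (hda : translate d axis = axis) (σ : Bool) : translate d (region C Γ σ) = region C Γ σ := by
  apply Set.Subset.antisymm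
  · rintro _ ⟨x, hx, rfl⟩; exact H.act_mem_region hd hda hx
  · intro x hx
    exact mem_translate.2 (H.act_mem_region (Γ.inv_mem hd) (translate_inv_eq hda) hx)

theorem translate_zpow_axis (H : IsMarkedSurface C Γ γ t) (n : ℤ) :
    translate (γ ^ n) axis = axis := by
  ext x
  rw [mem_translate, ← zpow_neg]
  simp only [mem_axis_iff, H.act_zpow]
  simp [Real.exp_pos]

theorem region_subset (σ : Bool) : region C Γ σ ⊆ C :=
  fun _ hx => hx.1.1

/-- To change sides a component would have to meet `x₁ = 0`, which inside `C` is the axis and hence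
a lift. -/
theorem connectedComponentIn_subset_region (H : IsMarkedSurface C Γ γ t) {σ : Bool} {x : V}
    (hx : x ∈ region C Γ σ) : connectedComponentIn (C \ lifts Γ) x ⊆ region C Γ σ := by
  intro y hy
  have hyC := connectedComponentIn_subset _ _ hy
  refine ⟨hyC, ?_, connectedComponentIn_eq hy ▸ hx.2.2⟩
  by_contra! hlt
  have hc : ContinuousOn (fun z : V => side σ * z 1) (connectedComponentIn (C \ lifts Γ) x) := by
    fun_prop
  obtain ⟨z, hz, hz0⟩ := isPreconnected_connectedComponentIn.intermediate_value hy
    (mem_connectedComponentIn hx.1) hc ⟨hlt, hx.2.1.le⟩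
  have hzC := connectedComponentIn_subset _ _ hz
  have hz1 : z 1 = 0 := by
    rcases mul_eq_zero.1 hz0 with h | h
    · have := side_sq σ
      rw [h] at this; norm_num at this
    · exact h
  exact hzC.2 (axis_subset_lifts (H.mem_axis hzC.1 hz1))

theorem isOpen_region (H : IsMarkedSurface C Γ γ t) (σ : Bool) : IsOpen (region C Γ σ) := by
  rw [isOpen_iff_mem_nhds]
  intro x hx
  exact mem_of_superset (H.isOpen_diff_lifts.connectedComponentIn.mem_nhds
    (mem_connectedComponentIn hx.1)) (H.connectedComponentIn_subset_region hx)

theorem axis_subset_closure_region (H : IsMarkedSurface C Γ γ t) {σ : Bool}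
    (hne : (region C Γ σ).Nonempty) : axis ⊆ closure (region C Γ σ) := by
  obtain ⟨x, hx⟩ := hne
  exact hx.2.2.trans (closure_mono (H.connectedComponentIn_subset_region hx))

theorem side_nonneg_of_mem_closure {σ : Bool} {x : V} (hx : x ∈ closure (region C Γ σ)) :
    0 ≤ side σ * x 1 := by
  have hcl : IsClosed {x : V | 0 ≤ side σ * x 1} :=
    isClosed_le continuous_const (continuous_const.mul (continuous_apply 1))
  have hsub : region C Γ σ ⊆ {x : V | 0 ≤ side σ * x 1} := fun x hx => hx.2.1.le
  exact closure_minimal hsub hcl hx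

theorem region_subset_openTriangle (H : IsMarkedSurface C Γ γ t) (σ : Bool) :
    region C Γ σ ⊆ openTriangle (side σ) :=
  fun _ hx => ⟨H.pos_zero hx.1.1, hx.2.1, H.pos_two hx.1.1⟩

theorem eq_of_translate_region (H : IsMarkedSurface C Γ γ t)
    (hne : ∀ σ, (region C Γ σ).Nonempty) {d : SL3} (hd : d ∈ Γ)
    (hda : translate d axis = axis) {σ ρ : Bool}
    (h : translate d (region C Γ ρ) = region C Γ σ) : ρ = σ := by
  rw [H.translate_region hd hda] at h
  obtain ⟨x, hx⟩ := hne ρ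
  have h1 := hx.2.1
  rw [h] at hx
  have h2 := hx.2.1
  cases σ <;> cases ρ <;> simp [side] at * <;> linarith

/-- An adjacent lift lies on the side of the region. -/
theorem isOnSide (H : IsMarkedSurface C Γ γ t) (hne : ∀ σ, (region C Γ σ).Nonempty) {h : SL3}
    (hh : h ∈ Γ) (hha : translate h axis ≠ axis) {σ ρ : Bool}
    (hr : translate h (region C Γ ρ) = region C Γ σ) : IsOnSide (side σ) h := by
  intro x hx
  have h1 : act h x ∈ closure (region C Γ σ) := by
    rw [← hr, closure_translate]
    exact act_mem_translate h (H.axis_subset_closure_region (hne ρ) hx)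
  refine (side_nonneg_of_mem_closure h1).lt_of_ne' (mul_ne_zero ?_ (H.act_one_ne_zero hh hha hx))
  intro h0
  have := side_sq σ
  rw [h0] at this; norm_num at this

end IsMarkedSurface

/-! ### Normal words in the bulged group and ping-pong. -/

/-- Words describing the pieces of the bulged domain, in which no geodesic is crossed twice in
succession, from the point of view of the region on the side `σ`; the piece is the image of the
region on the side `τ`. -/
inductive IsNormalWord (C : Set V) (Γ : Subgroup SL3) (s : ℝ) : Bool → SL3 → Bool → Prop
  | base {σ τ : Bool} {g : SL3} (hg : g ∈ Γ) (h : translate g (region C Γ τ) = region C Γ σ) :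
      IsNormalWord C Γ s σ g τ
  | cross {σ ρ τ : Bool} {h G : SL3} (hh : h ∈ Γ)
      (hr : translate h (region C Γ ρ) = region C Γ σ) (hha : translate h axis ≠ axis)
      (hG : IsNormalWord C Γ s (!ρ) G τ) :
      IsNormalWord C Γ s σ (h * bulge (side (!ρ) * s) * G) τ

/-- A normal word, possibly preceded by a crossing of the axis itself. -/
def IsReducedWord (C : Set V) (Γ : Subgroup SL3) (s : ℝ) (σ : Bool) (G : SL3) (τ : Bool) : Prop :=
  IsNormalWord C Γ s σ G τ ∨ ∃ d ∈ Γ, translate d axis = axis ∧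
    ∃ G', IsNormalWord C Γ s (!σ) G' τ ∧ G = d * bulge (side (!σ) * s) * G'

theorem bulge_side_mul (σ : Bool) (s : ℝ) :
    bulge (side σ * s) * bulge (side (!σ) * s) = 1 := by
  rw [side_not, neg_mul]; exact bulge_mul_bulge_neg _

/-- The factor `h` is absorbed into the first letter. If the product comes to stabilise the axis, it
also preserves sides, and the word becomes one that starts by crossing the axis. -/
theorem IsReducedWord.mul_left (H : IsMarkedSurface C Γ γ t) (hne : ∀ σ, (region C Γ σ).Nonempty)
    {s : ℝ} {σ σ' τ : Bool} {G h : SL3} (hG : IsReducedWord C Γ s σ G τ) (hh : h ∈ Γ)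
    (hr : translate h (region C Γ σ) = region C Γ σ') : IsReducedWord C Γ s σ' (h * G) τ := by
  rcases hG with hG | ⟨d, hd, hda, G', hG', rfl⟩
  · cases hG with
    | base hg h1 =>
      exact Or.inl (.base (Γ.mul_mem hh hg) (by rw [translate_mul, h1, hr]))
    | @cross _ ρ _ k G hk h1 hka hG =>
      have hr' : translate (h * k) (region C Γ ρ) = region C Γ σ' := by rw [translate_mul, h1, hr]
      have hm := Γ.mul_mem hh hk
      by_cases ha : translate (h * k) axis = axis
      · obtain rfl := H.eq_of_translate_region hne hm ha hr'
        exact Or.inr ⟨h * k, hm, ha, G, hG, by simp only [mul_assoc]⟩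
      · have := IsNormalWord.cross hm hr' ha hG
        left
        simpa only [mul_assoc] using this
  · have hr' : translate (h * d) (region C Γ σ) = region C Γ σ' := by
      rw [translate_mul, H.translate_region hd hda, hr]
    have hm := Γ.mul_mem hh hd
    by_cases ha : translate (h * d) axis = axis
    · obtain rfl := H.eq_of_translate_region hne hm ha hr'
      exact Or.inr ⟨h * d, hm, ha, G', hG', by simp only [mul_assoc]⟩
    · have := IsNormalWord.cross hm hr' ha hG'
      left
      simpa only [mul_assoc] using this

/-- A crossing of the axis is either prepended or cancels one already present; the cancellation
works because `d` commutes with the bulge (`commute_bulge`). -/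
theorem IsReducedWord.bulge_mul (H : IsMarkedSurface C Γ γ t)
    (hne : ∀ σ, (region C Γ σ).Nonempty) {s : ℝ} {σ τ : Bool} {G : SL3}
    (hG : IsReducedWord C Γ s σ G τ) :
    IsReducedWord C Γ s (!σ) (bulge (side σ * s) * G) τ := by
  rcases hG with hG | ⟨d, hd, hda, G', hG', rfl⟩
  · exact Or.inr ⟨1, Γ.one_mem, by simp, G, by simpa using hG, by simp⟩
  · have e : bulge (side σ * s) * (d * bulge (side (!σ) * s) * G') = d * G' := by
      rw [← mul_assoc, ← mul_assoc, H.commute_bulge hd hda, mul_assoc d, bulge_side_mul, mul_one]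
    rw [e]
    exact IsReducedWord.mul_left H hne (Or.inl hG') hd (H.translate_region hd hda _)

theorem bulge_true (s : ℝ) : bulge (side true * s) = bulge s := by simp [side]

theorem bulge_false (s : ℝ) : bulge (side false * s) = (bulge s)⁻¹ := by
  rw [← bulge_neg]; simp [side]

theorem isReducedWord_of_mem_bulgedGroup (H : IsMarkedSurface C Γ γ t)
    (hne : ∀ σ, (region C Γ σ).Nonempty) {s : ℝ} {g : SL3} (hg : g ∈ bulgedGroup C Γ s)
    {G : SL3} {τ : Bool} (hG : IsReducedWord C Γ s false G τ) :
    IsReducedWord C Γ s false (g * G) τ := by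
  have hT : ∀ {G : SL3}, IsReducedWord C Γ s true G τ →
      IsReducedWord C Γ s false (bulge s * G) τ := fun {G} h => by
    have := IsReducedWord.bulge_mul H hne h
    rwa [bulge_true] at this
  have hF : ∀ {G : SL3}, IsReducedWord C Γ s false G τ →
      IsReducedWord C Γ s true ((bulge s)⁻¹ * G) τ := fun {G} h => by
    have := IsReducedWord.bulge_mul H hne h
    rwa [bulge_false] at this
  unfold bulgedGroup at hg
  rw [← region_true, ← region_false] at hg
  induction hg using Subgroup.closure_induction_left with
  | one => simpa using hG
  | mul_left x hx y hy ih =>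
    rw [mul_assoc]
    -- Seen from the left region: `Γ₁` moves without crossing, a conjugate `O_s k O_s⁻¹` crosses,
    -- moves on the right and returns, and `O_s γ₂` moves to the right and crosses back.
    rcases hx with (⟨hx, hr⟩ | ⟨h, hh, hr, rfl⟩) | ⟨h, hh, hr, rfl⟩
    · exact ih.mul_left H hne hx hr
    · have := hT ((hF ih).mul_left H hne hh hr)
      simpa only [mul_assoc] using this
    · have := hT (ih.mul_left H hne hh hr)
      simpa only [mul_assoc] using this
  | inv_mul_cancel x hx y hy ih =>
    rw [mul_assoc]
    rcases hx with (⟨hx, hr⟩ | ⟨h, hh, hr, rfl⟩) | ⟨h, hh, hr, rfl⟩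
    · exact ih.mul_left H hne (Γ.inv_mem hx) (translate_inv_eq hr)
    · have := hT ((hF ih).mul_left H hne (Γ.inv_mem hh) (translate_inv_eq hr))
      simpa only [mul_assoc, mul_inv_rev, inv_inv] using this
    · have := (hF ih).mul_left H hne (Γ.inv_mem hh) (translate_inv_eq hr)
      simpa only [mul_assoc, mul_inv_rev, inv_inv] using this

theorem isReducedWord_false (H : IsMarkedSurface C Γ γ t)
    (hne : ∀ σ, (region C Γ σ).Nonempty) {s : ℝ} {g : SL3} (hg : g ∈ bulgedGroup C Γ s) :
    IsReducedWord C Γ s false g false := by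
  have h1 : IsReducedWord C Γ s false 1 false := Or.inl (.base Γ.one_mem (by simp))
  simpa using isReducedWord_of_mem_bulgedGroup H hne hg h1

theorem isReducedWord_true (H : IsMarkedSurface C Γ γ t)
    (hne : ∀ σ, (region C Γ σ).Nonempty) {s : ℝ} {g : SL3} (hg : g ∈ bulgedGroup C Γ s) :
    IsReducedWord C Γ s false (g * bulge s) true := by
  have h1 : IsReducedWord C Γ s true 1 true := Or.inl (.base Γ.one_mem (by simp))
  have h2 := IsReducedWord.bulge_mul H hne h1
  rw [bulge_true, mul_one] at h2
  exact isReducedWord_of_mem_bulgedGroup H hne hg h2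

theorem act_bulge_mem_closedTriangle {ς s : ℝ} {x : V} (hx : x ∈ closedTriangle ς) :
    act (bulge s) x ∈ closedTriangle ς := by
  obtain ⟨h0, h1, h2⟩ := hx
  refine ⟨?_, ?_, ?_⟩
  · rw [act_bulge_zero]; positivity
  · rw [act_bulge_one, mul_left_comm]; positivity
  · rw [act_bulge_two]; positivity

theorem act_bulge_mem_openTriangle {ς s : ℝ} {x : V} (hx : x ∈ openTriangle ς) :
    act (bulge s) x ∈ openTriangle ς := by
  obtain ⟨h0, h1, h2⟩ := hx
  refine ⟨?_, ?_, ?_⟩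
  · rw [act_bulge_zero]; positivity
  · rw [act_bulge_one, mul_left_comm]; positivity
  · rw [act_bulge_two]; positivity

namespace IsNormalWord

/-- Ping-pong: the bulge preserves the triangles of the axis, and each letter maps the triangle
behind its lift into a triangle of the axis. -/
theorem act_mem_closedTriangle (H : IsMarkedSurface C Γ γ t) (hne : ∀ σ, (region C Γ σ).Nonempty)
    {s : ℝ} {σ τ : Bool} {G : SL3} (hG : IsNormalWord C Γ s σ G τ) {z : V} (hzC : z ∈ C)
    (hz : z ∈ closure (region C Γ τ)) : act G z ∈ closedTriangle (side σ) := by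
  induction hG with
  | base hg h =>
    have h1 := H.act_mem hg hzC
    refine ⟨(H.pos_zero h1).le, IsMarkedSurface.side_nonneg_of_mem_closure (Γ := Γ) (C := C) ?_,
      (H.pos_two h1).le⟩
    rw [← h, closure_translate]
    exact act_mem_translate _ hz
  | @cross σ ρ τ h G hh hr hha hG ih =>
    rw [act_mul, act_mul]
    refine H.act_mem_closedTriangle hh hha (H.isOnSide hne hh hha hr)
      (H.isOnSide hne (Γ.inv_mem hh) (translate_inv_ne hha) (translate_inv_eq hr)) (side_sq ρ) ?_
    rw [← side_not]
    exact act_bulge_mem_closedTriangle (ih hz)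

theorem act_mem_openTriangle (H : IsMarkedSurface C Γ γ t) (hne : ∀ σ, (region C Γ σ).Nonempty)
    {s : ℝ} {σ τ : Bool} {G : SL3} (hG : IsNormalWord C Γ s σ G τ) {z : V}
    (hz : z ∈ region C Γ τ) : act G z ∈ openTriangle (side σ) := by
  induction hG with
  | base hg h =>
    apply H.region_subset_openTriangle
    rw [← h]
    exact act_mem_translate _ hz
  | @cross σ ρ τ h G hh hr hha hG ih =>
    rw [act_mul, act_mul]
    refine H.act_mem_openTriangle hh hha (H.isOnSide hne hh hha hr)
      (H.isOnSide hne (Γ.inv_mem hh) (translate_inv_ne hha) (translate_inv_eq hr)) (side_sq ρ) ?_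
    rw [← side_not]
    exact act_bulge_mem_openTriangle (ih hz)

end IsNormalWord

theorem act_mem_bulgedDomain {s : ℝ} {k : SL3} (hk : k ∈ bulgedGroup C Γ s) {y : V}
    (hy : y ∈ bulgedDomain C Γ s) : act k y ∈ bulgedDomain C Γ s := by
  obtain ⟨g, hg, hyg⟩ := Set.mem_iUnion₂.1 hy
  refine Set.mem_biUnion ((bulgedGroup C Γ s).mul_mem hk hg) ?_
  rw [translate_mul]
  exact act_mem_translate k hyg

theorem act_mem_closure_bulgedDomain {s : ℝ} {k : SL3} (hk : k ∈ bulgedGroup C Γ s) {y : V}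
    (hy : y ∈ closure (bulgedDomain C Γ s)) : act k y ∈ closure (bulgedDomain C Γ s) :=
  map_mem_closure (continuous_act k) hy fun _ h => act_mem_bulgedDomain hk h

theorem region_false_subset_bulgedDomain (s : ℝ) : region C Γ false ⊆ bulgedDomain C Γ s := by
  intro x hx
  refine Set.mem_biUnion (bulgedGroup C Γ s).one_mem ?_
  rw [translate_one, ← region_false]
  exact Or.inl ⟨subset_closure hx, hx.1.1⟩

theorem translate_region_true_subset_bulgedDomain (s : ℝ) :
    translate (bulge s) (region C Γ true) ⊆ bulgedDomain C Γ s := by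
  rintro _ ⟨x, hx, rfl⟩
  refine Set.mem_biUnion (bulgedGroup C Γ s).one_mem ?_
  rw [translate_one, ← region_true]
  exact Or.inr (act_mem_translate _ ⟨subset_closure hx, hx.1.1⟩)

theorem stabilizer_mem_bulgedGroup {s : ℝ} {k : SL3} (hk : k ∈ Γ)
    (h : translate k (region C Γ false) = region C Γ false) : k ∈ bulgedGroup C Γ s := by
  rw [region_false] at h
  exact Subgroup.subset_closure (Or.inl (Or.inl ⟨hk, h⟩))

theorem bulge_mul_mem_bulgedGroup {s : ℝ} {k : SL3} (hk : k ∈ Γ)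
    (h : translate k (region C Γ false) = region C Γ true) : bulge s * k ∈ bulgedGroup C Γ s := by
  rw [region_false, region_true] at h
  exact Subgroup.subset_closure (Or.inr ⟨k, hk, h, rfl⟩)

theorem isSeparating_iff : IsSeparating C Γ ↔
    ∀ g ∈ Γ, translate g (region C Γ false) ≠ region C Γ true := by
  rw [region_false, region_true]; rfl

theorem exists_word_of_mem_bulgedDomain (H : IsMarkedSurface C Γ γ t)
    (hne : ∀ σ, (region C Γ σ).Nonempty) {s : ℝ} {y : V} (hy : y ∈ bulgedDomain C Γ s) :
    ∃ G τ z, IsReducedWord C Γ s false G τ ∧ z ∈ C ∧ z ∈ closure (region C Γ τ) ∧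
      y = act G z := by
  obtain ⟨g, hg, z, hz | ⟨z, hz, rfl⟩, rfl⟩ := Set.mem_iUnion₂.1 hy
  · rw [← region_false] at hz
    exact ⟨g, false, z, isReducedWord_false H hne hg, hz.2, hz.1, rfl⟩
  · rw [← region_true] at hz
    exact ⟨g * bulge s, true, z, isReducedWord_true H hne hg, hz.2, hz.1, (act_mul _ _ _).symm⟩

theorem IsReducedWord.act_mem_closedTriangle (H : IsMarkedSurface C Γ γ t)
    (hne : ∀ σ, (region C Γ σ).Nonempty) {s : ℝ} {σ τ : Bool} {G : SL3}
    (hG : ∃ d ∈ Γ, translate d axis = axis ∧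
      ∃ G', IsNormalWord C Γ s (!σ) G' τ ∧ G = d * bulge (side (!σ) * s) * G')
    {z : V} (hzC : z ∈ C) (hz : z ∈ closure (region C Γ τ)) :
    act G z ∈ closedTriangle (side (!σ)) := by
  obtain ⟨d, hd, hda, G', hG', rfl⟩ := hG
  rw [act_mul, act_mul]
  obtain ⟨h0, h1, h2⟩ := act_bulge_mem_closedTriangle (s := side (!σ) * s)
    (hG'.act_mem_closedTriangle H hne hzC hz)
  obtain ⟨c, hc0, hc⟩ := H.stabilizer_diagonal hd hda
  refine ⟨?_, ?_, ?_⟩ <;> rw [hc]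
  · exact mul_nonneg (hc0 0).le h0
  · rw [mul_left_comm]; exact mul_nonneg (hc0 1).le h1
  · exact mul_nonneg (hc0 2).le h2

theorem nonneg_of_mem_bulgedDomain (H : IsMarkedSurface C Γ γ t)
    (hne : ∀ σ, (region C Γ σ).Nonempty) {s : ℝ} {y : V} (hy : y ∈ bulgedDomain C Γ s) :
    0 ≤ y 0 ∧ 0 ≤ y 2 := by
  obtain ⟨G, τ, z, hG, hzC, hz, rfl⟩ := exists_word_of_mem_bulgedDomain H hne hy
  rcases hG with hG | hG
  · have := hG.act_mem_closedTriangle H hne hzC hz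
    exact ⟨this.1, this.2.2⟩
  · have := IsReducedWord.act_mem_closedTriangle H hne hG hzC hz
    exact ⟨this.1, this.2.2⟩

namespace IsMarkedSurface

theorem isCone_bulgedDomain (H : IsMarkedSurface C Γ γ t) (s : ℝ) :
    IsCone (bulgedDomain C Γ s) := by
  have h1 : ∀ σ, IsCone (closure (region C Γ σ) ∩ C) := fun σ x hx r hr =>
    ⟨(H.isCone_region σ).closure x hx.1 r hr, H.isCone x hx.2 r hr⟩
  have h2 : IsCone ((closure (regionLeft C Γ) ∩ C) ∪
      translate (bulge s) (closure (regionRight C Γ) ∩ C)) := by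
    rw [← region_false, ← region_true]
    rintro x (hx | hx) r hr
    · exact Or.inl (h1 _ x hx r hr)
    · exact Or.inr ((h1 _).translate _ x hx r hr)
  intro x hx r hr
  obtain ⟨g, hg, hxg⟩ := Set.mem_iUnion₂.1 hx
  exact Set.mem_biUnion hg (h2.translate g x hxg r hr)

theorem zpow_mem_bulgedGroup (H : IsMarkedSurface C Γ γ t) (n : ℤ) (s : ℝ) :
    γ ^ n ∈ bulgedGroup C Γ s :=
  stabilizer_mem_bulgedGroup (H.zpow_mem n) (H.translate_region (H.zpow_mem n)
    (H.translate_zpow_axis n) _)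

/-! ### A supporting functional that does not depend on `s`. -/

/-- A linear functional that is nonnegative on `C` and positive at the neutral fixed point. -/
theorem exists_functional (H : IsMarkedSurface C Γ γ t) : ∃ f₀ f₁ f₂ : ℝ, 0 ≤ f₀ ∧ 0 < f₁ ∧
    0 ≤ f₂ ∧ ∀ x ∈ C, 0 ≤ f₀ * x 0 + f₁ * x 1 + f₂ * x 2 := by
  -- Otherwise rescaling puts `(0, -1, 0)` in the closure, on the line `x₀ = 0` but away from the
  -- repelling point.
  obtain ⟨M, hM0, hM⟩ : ∃ M : ℝ, 0 < M ∧ (![1, -M, 1] : V) ∉ C := by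
    by_contra! h
    have h1 : (![0, -1, 0] : V) ∈ closure C := by
      refine mem_closure_of_tendsto (f := fun u : ℝ => (![u, -1, u] : V)) (b := 𝓝[>] 0) ?_ ?_
      · have : Continuous fun u : ℝ => (![u, -1, u] : V) := by fun_prop
        exact (this.tendsto 0).mono_left nhdsWithin_le_nhds
      · filter_upwards [self_mem_nhdsWithin] with u hu
        have hu : 0 < u := hu
        convert H.isCone _ (h u⁻¹ (inv_pos.2 hu)) u hu using 1
        funext i; fin_cases i <;> simp [hu.ne']
    have := H.one_eq_zero_of_zero_eq_zero h1 (by simp)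
    simp at this
  obtain ⟨f, hf⟩ := geometric_hahn_banach_open_point H.surface.convex H.surface.isOpen hM
  have hfx : ∀ x : V, f x = f ![1, 0, 0] * x 0 + f ![0, 1, 0] * x 1 + f ![0, 0, 1] * x 2 := by
    intro x
    have e : x = x 0 • ![1, 0, 0] + x 1 • ![0, 1, 0] + x 2 • ![0, 0, 1] := by
      funext i; fin_cases i <;> simp
    conv_lhs => rw [e]
    simp only [map_add, map_smul, smul_eq_mul]
    ring
  have hneg : ∀ x ∈ C, f x ≤ 0 := by
    intro x hx
    by_contra! hpos
    have := hf _ (H.isCone x hx ((|f ![1, -M, 1]| + 1) / f x) (by positivity))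
    rw [map_smul, smul_eq_mul, div_mul_cancel₀ _ hpos.ne'] at this
    linarith [le_abs_self (f ![1, -M, 1])]
  have hclos : ∀ x ∈ closure C, f x ≤ 0 := by
    have hcl : IsClosed {x : V | f x ≤ 0} := isClosed_le f.continuous continuous_const
    exact fun x hx => closure_minimal hneg hcl hx
  have hu : 0 ≤ f ![1, -M, 1] := by
    obtain ⟨x, hx⟩ := H.surface.nonempty
    by_contra! hlt
    have h0 := hneg x hx
    have h1 := hf _ (H.isCone x hx (f ![1, -M, 1] / (f x - 1))
      (div_pos_of_neg_of_neg hlt (by linarith)))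
    rw [map_smul, smul_eq_mul, div_mul_eq_mul_div, div_lt_iff_of_neg (by linarith)] at h1
    nlinarith
  have h0 := hclos _ (frontier_subset_closure H.single_zero_mem_frontier)
  have h2 := hclos _ (frontier_subset_closure H.single_two_mem_frontier)
  rw [hfx] at hu
  simp at hu
  refine ⟨-f ![1, 0, 0], -f ![0, 1, 0], -f ![0, 0, 1], by linarith, ?_, by linarith,
    fun x hx => ?_⟩
  -- If `f` were nonnegative at the neutral point, its nonnegativity at `(1, -M, 1)` would force `f
  -- = 0`, against strict separation.
  · by_contra! hle
    have hle' : 0 ≤ f ![0, 1, 0] := by linarith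
    have hz0 : f ![1, 0, 0] = 0 := by nlinarith
    have hz2 : f ![0, 0, 1] = 0 := by nlinarith
    have hz1 : f ![0, 1, 0] = 0 := by
      rw [hz0, hz2] at hu
      nlinarith
    obtain ⟨x, hx⟩ := H.surface.nonempty
    have := hf x hx
    rw [hfx, hfx ![1, -M, 1], hz0, hz1, hz2] at this
    simp at this
  · have := hneg x hx
    rw [hfx] at this
    linarith

/-- A linear functional that is nonnegative on all bulged domains and positive at the neutral fixed
point. -/
theorem exists_functional_bulgedDomain (H : IsMarkedSurface C Γ γ t)
    (hne : ∀ σ, (region C Γ σ).Nonempty) : ∃ f₀ f₁ f₂ : ℝ, 0 ≤ f₀ ∧ 0 < f₁ ∧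
    0 ≤ f₂ ∧ ∀ s, ∀ x ∈ bulgedDomain C Γ s, 0 ≤ f₀ * x 0 + f₁ * x 1 + f₂ * x 2 := by
  -- The functional sought is coordinate `0` after applying `k`, that is, the first row of `k`. Its
  -- middle entry is positive because `k⁻¹ axis` lies on the left.
  have hrow : ∀ k ∈ Γ, ∀ σ, translate k axis ≠ axis →
      translate k (region C Γ false) = region C Γ σ →
      0 ≤ k.1 0 0 ∧ 0 < k.1 0 1 ∧ 0 ≤ k.1 0 2 := by
    intro k hk σ hka hr
    have o1 := H.isOnSide hne hk hka hr
    have o2 := H.isOnSide hne (Γ.inv_mem hk) (translate_inv_ne hka) (translate_inv_eq hr)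
    obtain ⟨⟨a0, -, -⟩, b0, -, -⟩ := H.columns_pos hk hka o1
    obtain ⟨c, -, -⟩ := H.middle_column hk hka o1 o2
    refine ⟨a0.le, ?_, b0.le⟩
    simpa [side] using c
  by_cases hsep : IsSeparating C Γ
  · by_cases hk : ∃ k ∈ Γ, translate k axis ≠ axis ∧
        translate k (region C Γ false) = region C Γ false
    · obtain ⟨k, hk, hka, hr⟩ := hk
      obtain ⟨h0, h1, h2⟩ := hrow k hk _ hka hr
      refine ⟨_, _, _, h0, h1, h2, fun s x hx => ?_⟩
      rw [← act_apply]
      exact (nonneg_of_mem_bulgedDomain H hne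
        (act_mem_bulgedDomain (stabilizer_mem_bulgedGroup hk hr) hx)).1
    -- With only the axis adjacent to the left region, a normal word seen from there is a single
    -- element of `Γ`. All other pieces lie to the right of the axis, so a functional supporting `C`
    -- suffices.
    · push Not at hk
      obtain ⟨f₀, f₁, f₂, h0, h1, h2, hf⟩ := H.exists_functional
      refine ⟨f₀, f₁, f₂, h0, h1, h2, fun s x hx => ?_⟩
      obtain ⟨G, τ, z, hG, hzC, hz, rfl⟩ := exists_word_of_mem_bulgedDomain H hne hx
      rcases hG with hG | hG
      · cases hG with
        | base hg _ => exact hf _ (H.act_mem hg hzC)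
        | @cross _ ρ _ h G hh hr hha hG =>
          cases ρ with
          | false => exact absurd hr (hk h hh hha)
          | true =>
            exact absurd (translate_inv_eq hr) (isSeparating_iff.1 hsep _ (Γ.inv_mem hh))
      · obtain ⟨x0, x1, x2⟩ := IsReducedWord.act_mem_closedTriangle H hne hG hzC hz
        simp only [Bool.not_false, side, one_mul] at x1
        positivity
  -- Now `O_s k` lies in the bulged group. The bulge only rescales coordinate `0`, so the row of `k`
  -- itself works for every `s`.
  · rw [isSeparating_iff] at hsep
    push Not at hsep
    obtain ⟨k, hk, hr⟩ := hsep
    have hka : translate k axis ≠ axis := fun h => by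
      simpa using H.eq_of_translate_region hne hk h hr
    obtain ⟨h0, h1, h2⟩ := hrow k hk _ hka hr
    refine ⟨_, _, _, h0, h1, h2, fun s x hx => ?_⟩
    rw [← act_apply]
    have := (nonneg_of_mem_bulgedDomain H hne
      (act_mem_bulgedDomain (bulge_mul_mem_bulgedGroup (s := s) hk hr) hx)).1
    rw [act_mul, act_bulge_zero] at this
    exact nonneg_of_mul_nonneg_right this (Real.exp_pos _)

end IsMarkedSurface

/-! ### Depth and the lower bound. -/

/-- The point `v` is on the right of the axis, and all its translates by powers of `γ` stay away
from the axis, with constant `ε`. -/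
def IsDeep (γ : SL3) (ε : ℝ) (v : V) : Prop :=
  0 < v 1 ∧ ∀ n : ℤ, ε * min (act (γ ^ n) v 0) (act (γ ^ n) v 2) ≤ act (γ ^ n) v 1

namespace IsMarkedSurface

/-- The source of the growth: relative to the outer coordinates, `O_s` stretches the middle one by
`exp s`. -/
theorem isDeep_bulge (H : IsMarkedSurface C Γ γ t) {ε s : ℝ} {v : V} (hv : IsDeep γ ε v) :
    IsDeep γ (ε * Real.exp s) (act (bulge s) v) := by
  refine ⟨by rw [act_bulge_one]; exact mul_pos (Real.exp_pos _) hv.1, fun n => ?_⟩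
  have := hv.2 n
  simp only [H.act_zpow] at this ⊢
  rw [act_bulge_zero, act_bulge_one, act_bulge_two, mul_left_comm, mul_left_comm (Real.exp (n * t 2)),
    mul_left_comm (Real.exp (n * t 1)), ← mul_min_of_nonneg _ _ (Real.exp_pos _).le]
  have e : Real.exp (2 / 3 * s) = Real.exp s * Real.exp (-(1 / 3) * s) := by
    rw [← Real.exp_add]; ring_nf
  rw [e]
  calc _ = Real.exp s * Real.exp (-(1 / 3) * s) *
        (ε * min (Real.exp (n * t 0) * v 0) (Real.exp (n * t 2) * v 2)) := by ring
    _ ≤ _ := by gcongr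

/-- Uniform in `s` and `G`: a word without crossing is covered by the orbit estimate for `J`. In any
other word only the first lift matters, because everything behind it lies in its triangle
(`exists_triangle_deep`). -/
theorem exists_isDeep (H : IsMarkedSurface C Γ γ t) (hne : ∀ σ, (region C Γ σ).Nonempty) {τ : Bool}
    {J : Set V} (hJ : IsCompact J) (hJτ : J ⊆ region C Γ τ) :
    ∃ ε : ℝ, 0 < ε ∧ ∀ s G, IsNormalWord C Γ s true G τ → ∀ j ∈ J, IsDeep γ ε (act G j) := by
  obtain ⟨ε₁, h₁, hd₁⟩ := H.exists_orbit_deep hJ (hJτ.trans (region_subset τ))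
    (fun g hg => Or.inr fun j hj h0 => (hJτ hj).1.2 ((act_mem_lifts_iff hg).1
      (axis_subset_lifts (H.mem_axis (H.act_mem hg (hJτ hj).1.1) h0))))
  obtain ⟨ε₂, h₂, hd₂⟩ := H.exists_triangle_deep
  refine ⟨min ε₁ ε₂, lt_min h₁ h₂, fun s G hG j hj => ?_⟩
  have hpos : ∀ n : ℤ, 0 < act (γ ^ n) (act G j) 0 ∧ 0 < act (γ ^ n) (act G j) 1 ∧
      0 < act (γ ^ n) (act G j) 2 := fun n => by
    obtain ⟨p0, p1, p2⟩ := hG.act_mem_openTriangle H hne (hJτ hj)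
    rw [side, one_mul] at p1
    simp only [H.act_zpow]
    exact ⟨by positivity, by positivity, by positivity⟩
  refine ⟨by simpa using (hpos 0).2.1, fun n => ?_⟩
  obtain ⟨p0, p1, p2⟩ := hpos n
  have hmin := (lt_min p0 p2).le
  cases hG with
  | base hg h =>
    have := (hd₁ _ (Γ.mul_mem (H.zpow_mem n) hg) j hj)
    rw [act_mul, abs_of_pos p1] at this
    exact (mul_le_mul_of_nonneg_right (min_le_left _ _) hmin).trans (this.resolve_left p1.ne')
  | @cross _ ρ _ h G hh hr hha hG =>
    refine (mul_le_mul_of_nonneg_right (min_le_right _ _) hmin).trans ?_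
    have hm := Γ.mul_mem (H.zpow_mem n) hh
    have hma : translate (γ ^ n * h) axis ≠ axis := fun h' => hha (by
      rw [translate_mul] at h'
      rw [← translate_inv_eq h', ← zpow_neg, H.translate_zpow_axis])
    have hmr : translate (γ ^ n * h) (region C Γ ρ) = region C Γ true := by
      rw [translate_mul, hr, H.translate_region (H.zpow_mem n) (H.translate_zpow_axis n)]
    have hv := act_bulge_mem_openTriangle (s := side (!ρ) * s)
      (hG.act_mem_openTriangle H hne (hJτ hj))
    rw [side_not] at hv
    have := hd₂ _ hm hma (H.isOnSide hne hm hma hmr) (side ρ) (side_sq ρ)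
      (H.isOnSide hne (Γ.inv_mem hm) (translate_inv_ne hma) (translate_inv_eq hmr)) _ hv
    simpa only [act_mul, side_not] using this

theorem IsDeep.mono (H : IsMarkedSurface C Γ γ t) {ε ε' : ℝ} (h : ε ≤ ε') {v : V} (h0 : 0 ≤ v 0)
    (h2 : 0 ≤ v 2) (hv : IsDeep γ ε' v) : IsDeep γ ε v := by
  refine ⟨hv.1, fun n => le_trans ?_ (hv.2 n)⟩
  refine mul_le_mul_of_nonneg_right h (le_min ?_ ?_) <;> rw [H.act_zpow] <;> positivity

/-- After a translation in the bulged group, the two points lie on different sides of the axis and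
the right one is far away from it. -/
theorem exists_separating_translate (H : IsMarkedSurface C Γ γ t)
    (hne : ∀ σ, (region C Γ σ).Nonempty) {A B : Set V} (hA : IsCompact A)
    (hAL : A ⊆ region C Γ false) (hB : IsCompact B) (hBR : B ⊆ region C Γ true) :
    ∃ ε : ℝ, 0 < ε ∧ ∀ s, ∀ a ∈ A, ∀ b ∈ B, ∀ g ∈ bulgedGroup C Γ s,
      (IsSeparating C Γ ∨ act g (act (bulge s) b) ∉ region C Γ false) →
      ∃ k ∈ bulgedGroup C Γ s,
        (act k a ∈ openTriangle (-1) ∧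
          IsDeep γ (ε * Real.exp s) (act k (act g (act (bulge s) b)))) ∨
        (IsDeep γ (ε * Real.exp s) (act k a) ∧
          act k (act g (act (bulge s) b)) ∈ openTriangle (-1)) := by
  obtain ⟨ε₁, h₁, hd₁⟩ := H.exists_isDeep hne hA hAL
  obtain ⟨ε₂, h₂, hd₂⟩ := H.exists_isDeep hne hB hBR
  refine ⟨min ε₁ ε₂, lt_min h₁ h₂, fun s a ha b hb g hg hcross => ?_⟩
  have hleft : ∀ {k : SL3}, k ∈ Γ → translate k (region C Γ false) = region C Γ false →
      act k a ∈ openTriangle (-1) := fun {k} hk hr => by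
    have h1 := act_mem_translate k (hAL ha)
    rw [hr] at h1
    exact H.region_subset_openTriangle false h1
  have hright : ∀ {G : SL3}, IsNormalWord C Γ s true G true →
      IsDeep γ (min ε₁ ε₂ * Real.exp s) (act (bulge s) (act G b)) := fun {G} hG => by
    obtain ⟨p0, -, p2⟩ := hG.act_mem_openTriangle H hne (hBR hb)
    exact H.isDeep_bulge (IsDeep.mono H (min_le_right _ _) p0.le p2.le (hd₂ s G hG b hb))
  have hG := isReducedWord_true H hne hg
  rw [← act_mul g]
  rw [← act_mul g] at hcross
  generalize g * bulge s = G at hG hcross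
  rcases hG with hG | ⟨d, hd, hda, G, hG, rfl⟩
  · cases hG with
    | base hh hr =>
      exfalso
      rcases hcross with hsep | hcross
      · exact isSeparating_iff.1 hsep _ (Γ.inv_mem hh) (translate_inv_eq hr)
      · exact hcross (hr ▸ act_mem_translate _ (hBR hb))
    | @cross _ ρ _ h G hh hr hha hG =>
      have hr' := translate_inv_eq hr
      -- The first lift crossed is moved onto the axis. If the piece before the crossing becomes the
      -- left region, `b` acquires the depth; if it becomes the right region, a bulge is needed to
      -- stay in `Γ_s`, and `a` acquires it.
      cases ρ with
      | false =>
        refine ⟨h⁻¹, stabilizer_mem_bulgedGroup (Γ.inv_mem hh) hr',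
          Or.inl ⟨hleft (Γ.inv_mem hh) hr', ?_⟩⟩
        rw [act_mul, act_mul, act_inv_act, Bool.not_false, bulge_true]
        exact hright hG
      | true =>
        refine ⟨bulge s * h⁻¹, bulge_mul_mem_bulgedGroup (Γ.inv_mem hh) hr', Or.inr ⟨?_, ?_⟩⟩
        · rw [act_mul]
          have hw : IsNormalWord C Γ s true h⁻¹ false := .base (Γ.inv_mem hh) hr'
          obtain ⟨p0, -, p2⟩ := hw.act_mem_openTriangle H hne (hAL ha)
          exact H.isDeep_bulge (IsDeep.mono H (min_le_left _ _) p0.le p2.le (hd₁ s _ hw a ha))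
        · rw [act_mul, act_mul, act_mul, act_inv_act, Bool.not_true, bulge_false, act_act_inv]
          exact hG.act_mem_openTriangle H hne (hBR hb)
  · have hda' := translate_inv_eq hda
    have hr := H.translate_region (Γ.inv_mem hd) hda' false
    refine ⟨d⁻¹, stabilizer_mem_bulgedGroup (Γ.inv_mem hd) hr,
      Or.inl ⟨hleft (Γ.inv_mem hd) hr, ?_⟩⟩
    rw [act_mul, act_mul, act_inv_act, Bool.not_false, bulge_true]
    exact hright hG

/-- The estimate of the cross ratio for points on different sides of the axis. -/
theorem mul_le_of_isDeep (H : IsMarkedSurface C Γ γ t) (hne : ∀ σ, (region C Γ σ).Nonempty)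
    {f₀ f₁ f₂ : ℝ} (hf₀ : 0 ≤ f₀) (hf₁ : 0 < f₁) (hf₂ : 0 ≤ f₂) {s : ℝ}
    (hf : ∀ x ∈ bulgedDomain C Γ s, 0 ≤ f₀ * x 0 + f₁ * x 1 + f₂ * x 2)
    {ε : ℝ} (hε : 0 < ε) {x y : V} (hx : x ∈ openTriangle (-1)) (hy : IsDeep γ ε y)
    {τ σ : ℝ} (hτ : 0 < τ) (hσ : 0 < σ)
    (h1 : x - τ • y ∈ closure (bulgedDomain C Γ s))
    (h2 : y - σ • x ∈ closure (bulgedDomain C Γ s)) :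
    τ * σ ≤ (f₀ * Real.exp (t 0 - t 2) + f₂ + 1) / (f₁ * ε) := by
  have hcont : Continuous fun x : V => f₀ * x 0 + f₁ * x 1 + f₂ * x 2 := by fun_prop
  have hcl : IsClosed {x : V | (0 ≤ x 0 ∧ 0 ≤ x 2) ∧ 0 ≤ f₀ * x 0 + f₁ * x 1 + f₂ * x 2} :=
    ((isClosed_le continuous_const (continuous_apply 0)).inter
      (isClosed_le continuous_const (continuous_apply 2))).inter
      (isClosed_le continuous_const hcont)
  have hsub : bulgedDomain C Γ s ⊆
      {x : V | (0 ≤ x 0 ∧ 0 ≤ x 2) ∧ 0 ≤ f₀ * x 0 + f₁ * x 1 + f₂ * x 2} :=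
    fun x hx => ⟨nonneg_of_mem_bulgedDomain H hne hx, hf x hx⟩
  obtain ⟨x0, x1, x2⟩ := hx
  -- Both points are moved by the same power of `γ`, so that the outer coordinates of `x` become
  -- comparable.
  obtain ⟨n, n1, n2⟩ := H.exists_zpow x0 x2
  have k1 := closure_minimal hsub hcl
    (act_mem_closure_bulgedDomain (H.zpow_mem_bulgedGroup n s) h1)
  have k2 := closure_minimal hsub hcl
    (act_mem_closure_bulgedDomain (H.zpow_mem_bulgedGroup n s) h2)
  have hd := hy.2 n
  have X2 : 0 < act (γ ^ n) x 2 := by rw [H.act_zpow]; positivity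
  have X1 : act (γ ^ n) x 1 < 0 := by
    rw [H.act_zpow]; exact mul_neg_of_pos_of_neg (Real.exp_pos _) (by linarith)
  rw [act_sub, act_smul] at k1 k2
  set X := act (γ ^ n) x
  set Y := act (γ ^ n) y
  obtain ⟨-, k1⟩ := k1
  obtain ⟨⟨k20, k22⟩, -⟩ := k2
  simp only [Pi.sub_apply, Pi.smul_apply, smul_eq_mul] at k1 k20 k22
  have hl := Real.exp_pos (t 0 - t 2)
  set l := Real.exp (t 0 - t 2)
  have hY0 : 0 ≤ Y 0 := by nlinarith
  have hY2 : 0 ≤ Y 2 := by nlinarith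
  -- `Y - σ X` has nonnegative outer coordinates, so those of `Y` are at least `σ X₂`, and depth
  -- turns this into a bound on `Y₁`. The functional on `X - τ Y` then bounds `τ Y₁` by a multiple
  -- of `X₂`.
  have hm : σ * X 2 ≤ min (Y 0) (Y 2) := le_min (by nlinarith) (by linarith)
  have hY1 : ε * (σ * X 2) ≤ Y 1 := (mul_le_mul_of_nonneg_left hm hε.le).trans hd
  have e1 : τ * (f₁ * (ε * (σ * X 2))) ≤ τ * (f₀ * Y 0 + f₁ * Y 1 + f₂ * Y 2) := by
    have := mul_le_mul_of_nonneg_left hY1 hf₁.le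
    have := mul_nonneg hf₀ hY0
    have := mul_nonneg hf₂ hY2
    exact mul_le_mul_of_nonneg_left (by linarith) hτ.le
  have e2 : f₀ * X 0 + f₁ * X 1 + f₂ * X 2 ≤ (f₀ * l + f₂ + 1) * X 2 := by
    have := mul_le_mul_of_nonneg_left n2 hf₀
    have := mul_neg_of_pos_of_neg hf₁ X1
    nlinarith
  rw [le_div_iff₀ (by positivity)]
  refine le_of_mul_le_mul_right ?_ X2
  nlinarith

theorem exists_le_hilbertDist (H : IsMarkedSurface C Γ γ t) (hne : ∀ σ, (region C Γ σ).Nonempty)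
    {A B : Set V} (hA : IsCompact A)
    (hAL : A ⊆ region C Γ false) (hB : IsCompact B) (hBR : B ⊆ region C Γ true) :
    ∃ c s₀ : ℝ, ∀ s, s₀ ≤ s → ∀ a ∈ A, ∀ b ∈ B, ∀ g ∈ bulgedGroup C Γ s,
      (IsSeparating C Γ ∨ act g (act (bulge s) b) ∉ region C Γ false) →
      1 / 2 * s - c ≤ hilbertDist (bulgedDomain C Γ s) a (act g (act (bulge s) b)) := by
  obtain ⟨ε, hε, hsep⟩ := H.exists_separating_translate hne hA hAL hB hBR
  obtain ⟨f₀, f₁, f₂, hf₀, hf₁, hf₂, hf⟩ := H.exists_functional_bulgedDomain hne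
  set K := (f₀ * Real.exp (t 0 - t 2) + f₂ + 1) / (f₁ * ε) with hK
  have hK0 : 0 < K := by positivity
  -- The threshold `log K + 1` makes `K exp (-s) < 1`, as `le_hilbertDist` requires. The summand `1`
  -- in `K` ensures `K > 0`.
  refine ⟨1 / 2 * Real.log K, Real.log K + 1, fun s hs a ha b hb g hg hcross => ?_⟩
  have hK1 : (f₀ * Real.exp (t 0 - t 2) + f₂ + 1) / (f₁ * (ε * Real.exp s)) =
      K * Real.exp (-s) := by
    rw [hK, Real.exp_neg]; field_simp
  have hlt : K * Real.exp (-s) < 1 := by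
    rw [← Real.exp_log hK0, ← Real.exp_add, Real.exp_lt_one_iff]
    linarith
  have hlog : -(1 / 2) * Real.log (K * Real.exp (-s)) = 1 / 2 * s - 1 / 2 * Real.log K := by
    rw [Real.log_mul hK0.ne' (Real.exp_ne_zero _), Real.log_exp]; ring
  rw [← hlog]
  obtain ⟨k, hk, hcase⟩ := hsep s a ha b hb g hg hcross
  have hεs : 0 < ε * Real.exp s := by positivity
  refine le_hilbertDist (H.isCone_bulgedDomain s)
    (fun z hz => (nonneg_of_mem_bulgedDomain H hne hz).1) ?_ ?_ ?_ hlt ?_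
  · intro ρ hρ h
    rw [h, act_smul] at hcase
    rcases hcase with ⟨⟨-, h1, -⟩, h2, -⟩ | ⟨⟨h1, -⟩, -, h2, -⟩
    · simp only [Pi.smul_apply, smul_eq_mul] at h1
      have := mul_pos hρ h2
      linarith
    · simp only [Pi.smul_apply, smul_eq_mul] at h1
      have := pos_of_mul_pos_right h1 hρ.le
      linarith
  · exact interior_maximal (region_false_subset_bulgedDomain s) (H.isOpen_region false) (hAL ha)
  · have hopen := isOpen_translate g (isOpen_translate (bulge s) (H.isOpen_region true))
    refine interior_maximal ?_ hopen (act_mem_translate g (act_mem_translate _ (hBR hb)))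
    rintro _ ⟨z, hz, rfl⟩
    exact act_mem_bulgedDomain hg (translate_region_true_subset_bulgedDomain s hz)
  · intro τ σ hτ hσ h1 h2
    rw [← hK1]
    -- Only the two memberships are moved by `k`, with the same `τ` and `σ`, so invariance of the
    -- distance is not needed.
    have h1' := act_mem_closure_bulgedDomain hk h1
    have h2' := act_mem_closure_bulgedDomain hk h2
    rw [act_sub, act_smul] at h1' h2'
    rcases hcase with ⟨hx, hy⟩ | ⟨hx, hy⟩
    · exact H.mul_le_of_isDeep hne hf₀ hf₁ hf₂ (hf s) hεs hx hy hτ hσ h1' h2'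
    · rw [mul_comm τ σ]
      exact H.mul_le_of_isDeep hne hf₀ hf₁ hf₂ (hf s) hεs hy hx hσ hτ h2' h1'

/-! ### The upper bound. -/

theorem norm_act_bulge_le {s : ℝ} (hs : 0 ≤ s) (x : V) :
    ‖act (bulge s) x‖ ≤ Real.exp (2 / 3 * s) * ‖x‖ := by
  have h0 : Real.exp (-(1 / 3) * s) ≤ Real.exp (2 / 3 * s) := Real.exp_le_exp.2 (by linarith)
  rw [pi_norm_le_iff_of_nonneg (by positivity)]
  intro i
  have hi := norm_le_pi_norm x i
  fin_cases i
  · simp only [Fin.zero_eta, act_bulge_zero, norm_mul, Real.norm_of_nonneg (Real.exp_pos _).le]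
    gcongr; exact hi
  · simp only [Fin.mk_one, act_bulge_one, norm_mul, Real.norm_of_nonneg (Real.exp_pos _).le]
    gcongr; exact hi
  · simp only [Fin.reduceFinMk, act_bulge_two, norm_mul, Real.norm_of_nonneg (Real.exp_pos _).le]
    gcongr; exact hi

theorem norm_act_bulge_inv_le {s : ℝ} (hs : 0 ≤ s) (x : V) :
    ‖act (bulge s)⁻¹ x‖ ≤ Real.exp (1 / 3 * s) * ‖x‖ := by
  rw [← bulge_neg]
  have h0 : Real.exp (-(1 / 3) * -s) ≤ Real.exp (1 / 3 * s) := Real.exp_le_exp.2 (by linarith)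
  have h1 : Real.exp (2 / 3 * -s) ≤ Real.exp (1 / 3 * s) := Real.exp_le_exp.2 (by linarith)
  rw [pi_norm_le_iff_of_nonneg (by positivity)]
  intro i
  have hi := norm_le_pi_norm x i
  fin_cases i
  · simp only [Fin.zero_eta, act_bulge_zero, norm_mul, Real.norm_of_nonneg (Real.exp_pos _).le]
    gcongr; exact hi
  · simp only [Fin.mk_one, act_bulge_one, norm_mul, Real.norm_of_nonneg (Real.exp_pos _).le]
    gcongr; exact hi
  · simp only [Fin.reduceFinMk, act_bulge_two, norm_mul, Real.norm_of_nonneg (Real.exp_pos _).le]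
    gcongr; exact hi

/-- If subtracting a multiple of `v` leads out of a neighbourhood of `x`, the multiple is not
small. -/
theorem le_of_sub_smul_not_mem {U : Set V} {x v : V} {δ τ R : ℝ} (hU : Metric.ball x δ ⊆ U)
    (hτ : 0 < τ) (h : x - τ • v ∉ U) (hv : ‖v‖ ≤ R) (hR : 0 < R) : δ / R ≤ τ := by
  by_contra! hlt
  apply h
  apply hU
  rw [mem_ball_iff_norm, sub_sub_cancel_left, norm_neg, norm_smul, Real.norm_of_nonneg hτ.le]
  calc τ * ‖v‖ ≤ τ * R := by gcongr
    _ < δ := by rwa [lt_div_iff₀ hR] at hlt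

/-- Leaving the ball around `a` along `O_s b` costs `τ` of order `exp (-2s/3)`. Leaving the
`O_s`-image of the ball around `b` along `a` costs `σ` of order `exp (-s/3)`, measured after
applying `O_s⁻¹`. -/
theorem exists_hilbertDist_le (H : IsMarkedSurface C Γ γ t) {a b : V}
    (ha : a ∈ region C Γ false) (hb : b ∈ region C Γ true) :
    ∃ c : ℝ, ∀ s, 0 ≤ s →
      hilbertDist (bulgedDomain C Γ s) a (act (bulge s) b) ≤ 1 / 2 * s + c := by
  obtain ⟨δ₁, hδ₁, h₁⟩ := Metric.isOpen_iff.1 (H.isOpen_region false) a ha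
  obtain ⟨δ₂, hδ₂, h₂⟩ := Metric.isOpen_iff.1 (H.isOpen_region true) b hb
  set K := min 1 (δ₁ / (‖b‖ + 1) * (δ₂ / (‖a‖ + 1))) with hK
  have hK0 : 0 < K := lt_min one_pos (by positivity)
  refine ⟨-(1 / 2) * Real.log K, fun s hs => ?_⟩
  have hlog : -(1 / 2) * Real.log (K * Real.exp (-s)) = 1 / 2 * s + -(1 / 2) * Real.log K := by
    rw [Real.log_mul hK0.ne' (Real.exp_ne_zero _), Real.log_exp]; ring
  rw [← hlog]
  refine hilbertDist_le_of_forall (H.isCone_bulgedDomain s) ?_ (by positivity) ?_ ?_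
  · intro ρ hρ h
    have e := congrFun h 1
    have ha1 := ha.2.1
    have hb1 := hb.2.1
    rw [Pi.smul_apply, act_bulge_one, smul_eq_mul] at e
    simp only [side, one_mul] at ha1 hb1
    have : 0 < ρ * (Real.exp (2 / 3 * s) * b 1) := by positivity
    linarith
  · exact mul_le_one₀ (min_le_left _ _) (Real.exp_pos _).le (Real.exp_le_one_iff.2 (by linarith))
  · intro τ σ hτ hσ hx hy
    have k1 : δ₁ / (Real.exp (2 / 3 * s) * (‖b‖ + 1)) ≤ τ := by
      refine le_of_sub_smul_not_mem h₁ hτ (fun h => hx.2 ?_) ((norm_act_bulge_le hs b).trans ?_)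
        (by positivity)
      · exact interior_maximal (region_false_subset_bulgedDomain s) (H.isOpen_region false) h
      · gcongr; linarith
    have k2 : δ₂ / (Real.exp (1 / 3 * s) * (‖a‖ + 1)) ≤ σ := by
      refine le_of_sub_smul_not_mem h₂ hσ (fun h => hy.2 ?_)
        ((norm_act_bulge_inv_le hs a).trans ?_) (by positivity)
      · refine interior_maximal (translate_region_true_subset_bulgedDomain s)
          (isOpen_translate _ (H.isOpen_region true)) ?_
        have := act_mem_translate (bulge s) h
        rwa [act_sub, act_smul, act_act_inv] at this
      · gcongr; linarith
    have e : Real.exp (-s) = 1 / (Real.exp (2 / 3 * s) * Real.exp (1 / 3 * s)) := by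
      rw [← Real.exp_add, one_div, ← Real.exp_neg]; ring_nf
    calc K * Real.exp (-s) ≤ δ₁ / (‖b‖ + 1) * (δ₂ / (‖a‖ + 1)) * Real.exp (-s) := by
          gcongr; exact min_le_right _ _
      _ = δ₁ / (Real.exp (2 / 3 * s) * (‖b‖ + 1)) * (δ₂ / (Real.exp (1 / 3 * s) * (‖a‖ + 1))) := by
          rw [e]; field_simp
      _ ≤ τ * σ := by gcongr

end IsMarkedSurface

/-! ### From the two bounds to linear growth. -/

theorem isTheta_id_of_bounds {F : ℝ → ℝ} {c c' s₀ : ℝ}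
    (h : ∀ s, s₀ ≤ s → 1 / 2 * s - c ≤ F s ∧ F s ≤ 1 / 2 * s + c') :
    F =Θ[atTop] (fun s : ℝ => s) := by
  constructor
  · refine Asymptotics.IsBigO.of_bound 1 ?_
    filter_upwards [eventually_ge_atTop s₀, eventually_ge_atTop (2 * c'), eventually_ge_atTop 0,
      eventually_ge_atTop (2 * c)] with s h1 h2 h3 h4
    obtain ⟨h5, h6⟩ := h s h1
    rw [Real.norm_of_nonneg h3, Real.norm_of_nonneg (show 0 ≤ F s by linarith)]
    linarith
  · refine Asymptotics.IsBigO.of_bound 4 ?_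
    filter_upwards [eventually_ge_atTop s₀, eventually_ge_atTop (4 * c), eventually_ge_atTop 0]
      with s h1 h2 h3
    obtain ⟨h5, h6⟩ := h s h1
    rw [Real.norm_of_nonneg h3, Real.norm_of_nonneg (show 0 ≤ F s by linarith)]
    linarith

theorem sInf_mem_Icc {S : Set ℝ} {l u d : ℝ} (hl : ∀ x ∈ S, l ≤ x) (hd : d ∈ S) (hu : d ≤ u) :
    l ≤ sInf S ∧ sInf S ≤ u :=
  ⟨le_csInf ⟨d, hd⟩ hl, (csInf_le ⟨l, hl⟩ hd).trans hu⟩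

end Bulging

open Bulging

theorem mainTheorem6
    (C : Set Bulging.V) (Γ : Subgroup Bulging.SL3) (γ : Bulging.SL3)
    (hS : Bulging.IsStrictlyConvexSurface C Γ)
    (hγ : Bulging.IsSimpleClosedGeodesic C Γ γ)
    (A B : Set Bulging.V)
    (hA : IsCompact A) (hA₀ : A.Nonempty) (hAL : A ⊆ Bulging.regionLeft C Γ)
    (hB : IsCompact B) (hB₀ : B.Nonempty) (hBR : B ⊆ Bulging.regionRight C Γ) :
    (Bulging.IsSeparating C Γ →
      (fun s : ℝ => Bulging.surfaceDist (Bulging.bulgedDomain C Γ s) (Bulging.bulgedGroup C Γ s)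
        A (Bulging.translate (Bulging.bulge s) B)) =Θ[Filter.atTop] (fun s : ℝ => s)) ∧
    (¬ Bulging.IsSeparating C Γ →
      (fun s : ℝ => Bulging.crossingDist (Bulging.bulgedDomain C Γ s) (Bulging.bulgedGroup C Γ s)
        (Bulging.regionLeft C Γ) A (Bulging.translate (Bulging.bulge s) B))
          =Θ[Filter.atTop] (fun s : ℝ => s)) := by
  obtain ⟨t, H⟩ := exists_isMarkedSurface hS hγ
  obtain ⟨a, ha⟩ := hA₀
  obtain ⟨b, hb⟩ := hB₀
  rw [← region_false] at hAL
  rw [← region_true] at hBR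
  have hne : ∀ σ, (region C Γ σ).Nonempty := by
    rintro (_ | _)
    exacts [⟨a, hAL ha⟩, ⟨b, hBR hb⟩]
  obtain ⟨c, s₀, hlow⟩ := H.exists_le_hilbertDist hne hA hAL hB hBR
  obtain ⟨c', hup⟩ := H.exists_hilbertDist_le (hAL ha) (hBR hb)
  constructor
  · intro hsep
    refine isTheta_id_of_bounds (c := c) (c' := c') (s₀ := max s₀ 0) fun s hs => ?_
    obtain ⟨hs₀, hs0⟩ := max_le_iff.1 hs
    refine sInf_mem_Icc ?_ ⟨a, ha, _, act_mem_translate _ hb, 1, Subgroup.one_mem _, rfl⟩ ?_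
    · rintro d ⟨a, ha, _, ⟨b, hb, rfl⟩, g, hg, rfl⟩
      exact hlow s hs₀ a ha b hb g hg (Or.inl hsep)
    · rw [act_one]; exact hup s hs0
  · intro _
    refine isTheta_id_of_bounds (c := c) (c' := c') (s₀ := max s₀ 0) fun s hs => ?_
    obtain ⟨hs₀, hs0⟩ := max_le_iff.1 hs
    refine sInf_mem_Icc ?_ ⟨a, ha, _, act_mem_translate _ hb, 1, Subgroup.one_mem _, ?_, rfl⟩ ?_
    · rintro d ⟨a, ha, _, ⟨b, hb, rfl⟩, g, hg, hK, rfl⟩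
      exact hlow s hs₀ a ha b hb g hg (Or.inr (by rwa [region_false]))
    -- The pair realising the upper bound is admissible: `O_s b` has positive second coordinate, so
    -- it is not in the left region.
    · rw [act_one, ← region_false]
      intro h
      have h1 := h.2.1
      have h2 := (hBR hb).2.1
      rw [act_bulge_one] at h1
      simp only [side, one_mul] at h1 h2
      have : 0 < Real.exp (2 / 3 * s) * b 1 := by positivity
      linarith
    · rw [act_one]; exact hup s hs0
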